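/- Let $d\in\mathbb N$ and let $\mathbf T^d=\mathbb R^d/\mathbb Z^d$ be the flat unit torus with the norm $\|x\|=\max_i |x_i|$ (coordinates taken in $[-\frac12,\frac12]$) and its uniform probability measure $dx$. Let $F_{\rm in},F_{\rm out}:\mathbf T^d\to[0,1]$ be measurable functions such that $F_{\rm in}(x)$ and $F_{\rm out}(x)$ depend only on $\|x\|$, and put $\widehat F(k)=\int_{\mathbf T^d}F(x)e^{-2i\pi\langle k,x\rangle}\,dx$ for $k\in\mathbb Z^d$ (for $F = F_{\rm in}, F_{\rm out}$ these numbers are real). For even $n$, the soft geometric block model (SGBM) on $[n]$ is the following random graph. The labelling $\sigma:[n]\to\{1,2\}$ is uniform among all labellings in which each label occurs exactly $n/2$ times; the positions $X_1,\dots,X_n$ are independent, uniformly distributed on $\mathbf T^d$, and independent of $\sigma$; and, given $(\sigma,X)$, each pair $i<j$ is joined by an edge independently with probability $F_{\rm in}(X_i-X_j)$ if $\sigma_i=\sigma_j$ and $F_{\rm out}(X_i-X_j)$ if $\sigma_i\ne\sigma_j$. Let $A=A^{(n)}$ be the (symmetric, zero-diagonal) adjacency matrix, $\lambda_1,\dots,\lambda_n$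 its eigenvalues with multiplicity, and $$\mu_n=\sum_{i=1}^n\delta_{\lambda_i/n}$$ the (unnormalized) spectral measure of $\frac1nA$. Assume that $F_{\rm in}(0)$ and $F_{\rm out}(0)$ are equal to the Fourier series of $F_{\rm in}$ and $F_{\rm out}$ evaluated at $0$, the series being summed along some sequence $(S_j)$ of finite subsets of $\mathbb Z^d$ that eventually contains every given finite subset (for example, the cubes $[-j,j]^d\cap\mathbb Z^d$): $\lim_{j\to\infty}\sum_{k\in S_j}\widehat F_{\rm in}(k)=F_{\rm in}(0)$ and $\lim_{j\to\infty}\sum_{k\in S_j}\widehat F_{\rm out}(k)=F_{\rm out}(0)$. Let $$\mu=\sum_{k\in\mathbb Z^d}\Big(\delta_{\frac{\widehat F_{\rm in}(k)+\widehat F_{\rm out}(k)}2}+\delta_{\frac{\widehat F_{\rm in}(k)-\widehat F_{\rm out}(k)}2}\Big).$$ Then, for every sequence of SGBM graphs, one for each even $n$, defined on a common probability space (with arbitrary dependence between different $n$), and for every Borel set $B\subset\mathbb R$ with $\mu(\partial B)=0$ and $0\notin\overline B$, almost surely $$\lim_{n\to\infty,\ n\text{ even}}\mu_n(B)=\mu(B).$$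 -/

import Mathlib

open MeasureTheory ProbabilityTheory Filter Topology
open scoped ENNReal

noncomputable section

namespace SGBM

/-- The flat unit torus `ℝ^d / ℤ^d`. Its norm is `‖x‖ = max_i |x_i|`, where `|x_i|` is the distance
from `x_i` to the nearest integer. -/
abbrev Torus (d : ℕ) : Type := UnitAddTorus (Fin d)

/-- The uniform distribution (normalized Haar measure) on the torus. -/
def torusMeasure (d : ℕ) : Measure (Torus d) :=
  Measure.pi fun _ : Fin d => (AddCircle.haarAddCircle : Measure UnitAddCircle)

instance (d : ℕ) : IsProbabilityMeasure (torusMeasure d) := by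
  unfold torusMeasure; infer_instance

/-- A connectivity probability function: a measurable `F : 𝕋^d → [0, 1]` such that `F x` depends
only on the norm `‖x‖`. -/
structure IsConnectivityFunction {d : ℕ} (F : Torus d → ℝ) : Prop where
  measurable : Measurable F
  mem_Icc : ∀ x, F x ∈ Set.Icc (0 : ℝ) 1
  radial : ∀ x y, ‖x‖ = ‖y‖ → F x = F y

/-- The Fourier coefficient `∫ F(x) exp(-2πi⟨k, x⟩) dx` over the torus. -/
def fourierHat {d : ℕ} (F : Torus d → ℝ) (k : Fin d → ℤ) : ℂ :=
  UnitAddTorus.mFourierCoeff (fun x => (F x : ℂ)) k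

theorem fourierHat_eq_integral {d : ℕ} (F : Torus d → ℝ) (k : Fin d → ℤ) :
    fourierHat F k = ∫ x, UnitAddTorus.mFourier (-k) x * (F x : ℂ) ∂torusMeasure d := rfl

/-- The Fourier coefficients of a connectivity probability function are real (it is even), so
that taking their real part, as in `limitMeasure` below, loses nothing. -/
theorem fourierHat_im {d : ℕ} {F : Torus d → ℝ} (hF : IsConnectivityFunction F)
    (k : Fin d → ℤ) : (fourierHat F k).im = 0 := by
  have hinv : (torusMeasure d).IsNegInvariant := by
    unfold torusMeasure
    have : ∀ i : Fin d, (AddCircle.haarAddCircle : Measure UnitAddCircle).IsNegInvariant :=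
      fun _ => inferInstance
    exact Measure.pi.isNegInvariant _
  have hneg : ∀ x : Torus d,
      UnitAddTorus.mFourier (-k) (-x) = starRingEnd ℂ (UnitAddTorus.mFourier (-k) x) := by
    intro x
    rw [UnitAddTorus.mFourier_neg, UnitAddTorus.mFourier_neg, Complex.conj_conj]
    simp only [UnitAddTorus.mFourier, ContinuousMap.coe_mk, Pi.neg_apply, map_prod]
    refine Finset.prod_congr rfl fun i _ => ?_
    rw [← fourier_neg]
    simp [fourier_apply]
  have h1 : starRingEnd ℂ (fourierHat F k) = fourierHat F k := by
    rw [fourierHat_eq_integral, ← integral_conj, ← integral_neg_eq_self]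
    refine integral_congr_ae (Eventually.of_forall fun x => ?_)
    have hx : F (-x) = F x := hF.radial _ _ (norm_neg x)
    simp only [map_mul, Complex.conj_ofReal, hneg, Complex.conj_conj, hx]
  exact Complex.conj_eq_iff_im.mp h1

/-- The value `F 0` equals the Fourier series of `F` at `0`, i.e. `∑_k F̂(k)`, where the (possibly
only conditionally convergent) series is the limit of its partial sums over the finite sets
`S 0, S 1, …` of frequencies. -/
def EqualsFourierSeriesAtZero {d : ℕ} (S : ℕ → Finset (Fin d → ℤ)) (F : Torus d → ℝ) : Prop :=
  Tendsto (fun j => ∑ k ∈ S j, fourierHat F k) atTop (𝓝 (F 0 : ℂ))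

/-- The edge probability of two nodes at displacement `x` with labels `a` and `b`. -/
def edgeProb {d : ℕ} (fIn fOut : Torus d → ℝ) (x : Torus d) (a b : Fin 2) : ℝ :=
  if a = b then fIn x else fOut x

/-- The labellings of `2 * N` nodes in which both labels occur exactly `N` times. -/
def balancedLabellings (N : ℕ) : Set (Fin (2 * N) → Fin 2) :=
  {s | ∀ a : Fin 2, (Finset.univ.filter fun i => s i = a).card = N}

open Classical in
/-- The conditional probability of the graph `G`, given the labels `s` and the positions `x`. -/
def graphProb {d n : ℕ} (fIn fOut : Torus d → ℝ) (s : Fin n → Fin 2) (x : Fin n → Torus d)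
    (G : SimpleGraph (Fin n)) : ℝ :=
  ∏ p : Fin n × Fin n with p.1 < p.2,
    if G.Adj p.1 p.2 then edgeProb fIn fOut (x p.1 - x p.2) (s p.1) (s p.2)
    else 1 - edgeProb fIn fOut (x p.1 - x p.2) (s p.1) (s p.2)

/-- The joint law of (labels, positions, graph) in the model with `2 * N` nodes: the labels are
uniform over the balanced labellings, the positions are independent and uniform on the torus and
independent of the labels, and given both, the graph `G` has probability `graphProb`. -/
def law (d N : ℕ) (fIn fOut : Torus d → ℝ) :
    Measure ((Fin (2 * N) → Fin 2) × (Fin (2 * N) → Torus d) × SimpleGraph (Fin (2 * N))) :=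
  ((uniformOn (balancedLabellings N)).prod
    ((Measure.pi fun _ : Fin (2 * N) => torusMeasure d).prod Measure.count)).withDensity
      fun q => ENNReal.ofReal (graphProb fIn fOut q.1 q.2.1 q.2.2)

open Classical in
/-- The spectral measure `∑ᵢ δ_{λᵢ / n}`, where `λ₁, …, λₙ` are the eigenvalues (with multiplicity)
of the adjacency matrix of `G`. -/
def spectralMeasure {n : ℕ} (G : SimpleGraph (Fin n)) : Measure ℝ :=
  ∑ i : Fin n, Measure.dirac ((G.isHermitian_adjMatrix (R := ℝ)).eigenvalues i / (n : ℝ))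

/-- The measure `∑_k (δ_{(F̂_in(k) + F̂_out(k)) / 2} + δ_{(F̂_in(k) - F̂_out(k)) / 2})`, the sum being
over all `k ∈ ℤ^d`. -/
def limitMeasure {d : ℕ} (fIn fOut : Torus d → ℝ) : Measure ℝ :=
  Measure.sum fun k : Fin d → ℤ =>
    Measure.dirac (((fourierHat fIn k).re + (fourierHat fOut k).re) / 2) +
      Measure.dirac (((fourierHat fIn k).re - (fourierHat fOut k).re) / 2)

end SGBM

end

namespace SGBM

open Classical in
/-- Summing a product over pairs, with factors depending on adjacency, over all graphs. -/
theorem sum_graph_prod_ite {n : ℕ} (f g : Fin n × Fin n → ℝ) :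
    ∑ G : SimpleGraph (Fin n), ∏ p : Fin n × Fin n with p.1 < p.2,
      (if G.Adj p.1 p.2 then f p else g p) =
    ∏ p : Fin n × Fin n with p.1 < p.2, (f p + g p) := by
  rw [Finset.prod_add]
  refine Finset.sum_bij' (fun G _ => Finset.univ.filter fun p : Fin n × Fin n => p.1 < p.2 ∧ G.Adj p.1 p.2)
    (fun t _ => SimpleGraph.fromRel fun a b => a < b ∧ (a, b) ∈ t) ?_ ?_ ?_ ?_ ?_
  · intro G _
    rw [Finset.mem_powerset]
    intro p hp
    simp only [Finset.mem_filter, Finset.mem_univ, true_and] at hp ⊢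
    exact hp.1
  · intro t _
    exact Finset.mem_univ _
  · intro G _
    ext a b
    simp only [SimpleGraph.fromRel_adj, Finset.mem_filter, Finset.mem_univ, true_and]
    constructor
    · rintro ⟨_, h | h⟩
      · exact h.2.2
      · exact h.2.2.symm
    · intro h
      refine ⟨h.ne, ?_⟩
      rcases lt_or_gt_of_ne h.ne with h' | h'
      · exact Or.inl ⟨h', h', h⟩
      · exact Or.inr ⟨h', h', h.symm⟩
  · intro t ht
    rw [Finset.mem_powerset] at ht
    ext ⟨a, b⟩
    simp only [SimpleGraph.fromRel_adj, Finset.mem_filter, Finset.mem_univ, true_and]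
    constructor
    · rintro ⟨h, _, h' | h'⟩
      · exact h'.2
      · exact absurd h'.1 h.asymm
    · intro h
      have := (Finset.mem_filter.1 (ht h)).2
      exact ⟨this, this.ne, Or.inl ⟨this, h⟩⟩
  · intro G _
    rw [Finset.prod_ite, Finset.filter_filter]
    congr 1
    refine Finset.prod_congr ?_ fun _ _ => rfl
    ext p
    simp only [Finset.mem_filter, Finset.mem_univ, true_and, Finset.mem_sdiff]
    tauto

theorem edgeProb_neg {d : ℕ} {fIn fOut : Torus d → ℝ} (hIn : IsConnectivityFunction fIn)
    (hOut : IsConnectivityFunction fOut) (x : Torus d) (a b : Fin 2) :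
    edgeProb fIn fOut (-x) a b = edgeProb fIn fOut x b a := by
  simp only [edgeProb, eq_comm (a := a), hIn.radial (-x) x (norm_neg x),
    hOut.radial (-x) x (norm_neg x)]

theorem edgeProb_mem {d : ℕ} {fIn fOut : Torus d → ℝ} (hIn : IsConnectivityFunction fIn)
    (hOut : IsConnectivityFunction fOut) (x : Torus d) (a b : Fin 2) :
    edgeProb fIn fOut x a b ∈ Set.Icc (0 : ℝ) 1 := by
  unfold edgeProb
  split_ifs
  · exact hIn.mem_Icc x
  · exact hOut.mem_Icc x

theorem measurable_edgeProb {d : ℕ} {fIn fOut : Torus d → ℝ} (hIn : IsConnectivityFunction fIn)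
    (hOut : IsConnectivityFunction fOut) (a b : Fin 2) :
    Measurable fun x => edgeProb fIn fOut x a b := by
  unfold edgeProb
  split_ifs
  · exact hIn.measurable
  · exact hOut.measurable

open Classical in
/-- The indicator of adjacency of two vertices. -/
noncomputable def adjInd {V : Type*} (G : SimpleGraph V) (a b : V) : ℝ :=
  if G.Adj a b then 1 else 0

theorem adjInd_comm {V : Type*} (G : SimpleGraph V) (a b : V) : adjInd G a b = adjInd G b a := by
  classical exact if_congr (G.adj_comm a b) rfl rfl

/-- Distinct edges are present independently, given labels and positions. -/
theorem sum_graphProb_mul_prod_adjInd {d n : ℕ} {fIn fOut : Torus d → ℝ}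
    (hIn : IsConnectivityFunction fIn) (hOut : IsConnectivityFunction fOut)
    (s : Fin n → Fin 2) (x : Fin n → Torus d) {ι : Type*} [Fintype ι] (u v : ι → Fin n)
    (huv : ∀ i, u i ≠ v i) (hinj : Function.Injective fun i => s(u i, v i)) :
    ∑ G, graphProb fIn fOut s x G * ∏ i, adjInd G (u i) (v i) =
      ∏ i, edgeProb fIn fOut (x (u i) - x (v i)) (s (u i)) (s (v i)) := by
  classical
  set q : Fin n × Fin n → ℝ := fun p => edgeProb fIn fOut (x p.1 - x p.2) (s p.1) (s p.2) with hq
  set e : ι → Fin n × Fin n := fun i => if u i < v i then (u i, v i) else (v i, u i) with he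
  have hqe : ∀ i, q (e i) = edgeProb fIn fOut (x (u i) - x (v i)) (s (u i)) (s (v i)) := by
    intro i
    simp only [he, hq]
    split_ifs
    · rfl
    · rw [← neg_sub, edgeProb_neg hIn hOut]
  have hadj : ∀ (G : SimpleGraph (Fin n)) i,
      adjInd G (u i) (v i) = adjInd G (e i).1 (e i).2 := by
    intro G i
    simp only [he]
    split_ifs
    · rfl
    · exact adjInd_comm _ _ _
  have heP : ∀ i, (e i).1 < (e i).2 := by
    intro i
    simp only [he]
    split_ifs with h
    · exact h
    · exact lt_of_le_of_ne (not_lt.1 h) (huv i).symm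
  have hes : ∀ i, s((e i).1, (e i).2) = s(u i, v i) := by
    intro i
    simp only [he]
    split_ifs
    · rfl
    · exact Sym2.eq_swap
  have heinj : Function.Injective e := by
    intro i j hij
    apply hinj
    simp only [← hes, hij]
  set E : Finset (Fin n × Fin n) := Finset.univ.image e with hE
  have hEP : E ⊆ Finset.univ.filter fun p : Fin n × Fin n => p.1 < p.2 := by
    intro p hp
    obtain ⟨i, _, rfl⟩ := Finset.mem_image.1 hp
    simpa using heP i
  have hprod : ∀ r : Fin n × Fin n → ℝ, ∏ i, r (e i) =
      ∏ p : Fin n × Fin n with p.1 < p.2, if p ∈ E then r p else 1 := by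
    intro r
    rw [← Finset.prod_image (f := r) (g := e) (s := Finset.univ) (fun a _ b _ h => heinj h),
      Finset.prod_ite_mem, Finset.inter_eq_right.2 hEP]
  have key := sum_graph_prod_ite q (fun p => (1 - q p) * if p ∈ E then 0 else 1)
  calc _ = ∑ G : SimpleGraph (Fin n), ∏ p : Fin n × Fin n with p.1 < p.2,
      (if G.Adj p.1 p.2 then q p else (1 - q p) * if p ∈ E then 0 else 1) := by
        refine Finset.sum_congr rfl fun G _ => ?_
        simp only [hadj]
        rw [hprod (fun p => adjInd G p.1 p.2), graphProb, ← Finset.prod_mul_distrib]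
        refine Finset.prod_congr rfl fun p _ => ?_
        simp only [adjInd]
        split_ifs <;> simp [hq]
    _ = _ := by
        rw [key]
        simp only [← hqe]
        rw [hprod q]
        refine Finset.prod_congr rfl fun p _ => ?_
        split_ifs <;> simp

theorem sum_graphProb {d n : ℕ} {fIn fOut : Torus d → ℝ}
    (hIn : IsConnectivityFunction fIn) (hOut : IsConnectivityFunction fOut)
    (s : Fin n → Fin 2) (x : Fin n → Torus d) : ∑ G, graphProb fIn fOut s x G = 1 := by
  have := sum_graphProb_mul_prod_adjInd hIn hOut s x (ι := Fin 0) Fin.elim0 Fin.elim0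
    (fun i => i.elim0) (fun i => i.elim0)
  simpa using this

theorem graphProb_nonneg {d n : ℕ} {fIn fOut : Torus d → ℝ}
    (hIn : IsConnectivityFunction fIn) (hOut : IsConnectivityFunction fOut)
    (s : Fin n → Fin 2) (x : Fin n → Torus d) (G) : 0 ≤ graphProb fIn fOut s x G := by
  unfold graphProb
  refine Finset.prod_nonneg fun p _ => ?_
  have := edgeProb_mem hIn hOut (x p.1 - x p.2) (s p.1) (s p.2)
  split_ifs
  · exact this.1
  · linarith [this.2]

theorem graphProb_le_one {d n : ℕ} {fIn fOut : Torus d → ℝ}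
    (hIn : IsConnectivityFunction fIn) (hOut : IsConnectivityFunction fOut)
    (s : Fin n → Fin 2) (x : Fin n → Torus d) (G) : graphProb fIn fOut s x G ≤ 1 := by
  rw [← sum_graphProb hIn hOut s x]
  exact Finset.single_le_sum (fun G _ => graphProb_nonneg hIn hOut s x G) (Finset.mem_univ G)

theorem measurable_graphProb {d n : ℕ} {fIn fOut : Torus d → ℝ}
    (hIn : IsConnectivityFunction fIn) (hOut : IsConnectivityFunction fOut)
    (s : Fin n → Fin 2) (G) :
    Measurable fun x : Fin n → Torus d => graphProb fIn fOut s x G := by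
  unfold graphProb
  refine Finset.measurable_prod _ fun p _ => ?_
  have : Measurable fun x : Fin n → Torus d =>
      edgeProb fIn fOut (x p.1 - x p.2) (s p.1) (s p.2) :=
    (measurable_edgeProb hIn hOut _ _).comp ((measurable_pi_apply _).sub (measurable_pi_apply _))
  split_ifs
  · exact this
  · exact measurable_const.sub this

/-- Expansion of a power of a matrix as a sum over paths. -/
theorem sum_path_mul {V R : Type*} [Fintype V] [DecidableEq V] [CommRing R] (A : Matrix V V R) :
    ∀ (M : ℕ) (φ : V → V → R),
    ∑ w : Fin (M + 1) → V, (∏ k : Fin M, A (w k.castSucc) (w k.succ)) * φ (w 0) (w (Fin.last M)) =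
      ∑ i, ∑ j, (A ^ M) i j * φ i j
  | 0, φ => by
    rw [Fintype.sum_equiv (Equiv.funUnique (Fin 1) V) _ (fun a => φ a a) (fun w => by simp)]
    simp [Matrix.one_apply]
  | M + 1, φ => by
    rw [Fintype.sum_equiv (Fin.consEquiv fun _ : Fin (M + 2) => V).symm _
      (fun q => (∏ k : Fin M, A (q.2 k.castSucc) (q.2 k.succ)) *
        (A q.1 (q.2 0) * φ q.1 (q.2 (Fin.last M)))), Fintype.sum_prod_type]
    · calc _ = ∑ a, ∑ b, ∑ c, (A ^ M) b c * (A a b * φ a c) :=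
            Finset.sum_congr rfl fun a _ => sum_path_mul A M fun b c => A a b * φ a c
        _ = _ := by
            refine Finset.sum_congr rfl fun a _ => ?_
            rw [Finset.sum_comm]
            refine Finset.sum_congr rfl fun c _ => ?_
            rw [pow_succ', Matrix.mul_apply, Finset.sum_mul]
            refine Finset.sum_congr rfl fun b _ => by ring
    · intro w
      rw [Fin.prod_univ_succ]
      simp only [Fin.consEquiv, Equiv.coe_fn_symm_mk, Fin.tail, Fin.castSucc_zero, Fin.succ_castSucc,
        Fin.succ_last]
      ring

/-- Splitting a cyclic product into a path and the closing factor. -/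
theorem prod_cyclic {R V : Type*} [CommRing R] (M : ℕ) (g : Fin (M + 1) → V → V → R)
    (w : Fin (M + 1) → V) :
    ∏ k, g k (w k) (w (k + 1)) =
      (∏ k : Fin M, g k.castSucc (w k.castSucc) (w k.succ)) *
        g (Fin.last M) (w (Fin.last M)) (w 0) := by
  rw [Fin.prod_univ_castSucc]
  simp [Fin.coeSucc_eq_succ]

theorem trace_pow_eq_sum_cyclic {V R : Type*} [Fintype V] [DecidableEq V] [CommRing R]
    (A : Matrix V V R) (M : ℕ) :
    (A ^ (M + 1)).trace = ∑ w : Fin (M + 1) → V, ∏ k, A (w k) (w (k + 1)) := by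
  simp only [prod_cyclic M (fun _ a b => A a b)]
  rw [sum_path_mul A M fun i j => A j i, pow_succ, Matrix.trace]
  simp [Matrix.mul_apply]

theorem sum_eigenvalues_pow {V : Type*} [Fintype V] [DecidableEq V] {A : Matrix V V ℝ}
    (hA : A.IsHermitian) (m : ℕ) : ∑ i, hA.eigenvalues i ^ m = (A ^ m).trace := by
  conv_rhs => rw [hA.spectral_theorem]
  rw [← map_pow, Unitary.conjStarAlgAut_apply, Matrix.trace_mul_cycle]
  simp [Matrix.diagonal_pow, Matrix.trace]

theorem abs_eigenvalues_adjMatrix_le {n : ℕ} (G : SimpleGraph (Fin n)) [DecidableRel G.Adj]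
    (i : Fin n) : |(G.isHermitian_adjMatrix (R := ℝ)).eigenvalues i| ≤ n := by
  refine abs_le_of_sq_le_sq ?_ (Nat.cast_nonneg n)
  calc _ ≤ ∑ j, (G.isHermitian_adjMatrix (R := ℝ)).eigenvalues j ^ 2 :=
        Finset.single_le_sum (f := fun j => (G.isHermitian_adjMatrix (R := ℝ)).eigenvalues j ^ 2)
          (fun j _ => sq_nonneg _) (Finset.mem_univ i)
    _ = ∑ a : Fin n, ∑ b : Fin n, G.adjMatrix ℝ a b * G.adjMatrix ℝ b a := by
        rw [sum_eigenvalues_pow, pow_two]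
        simp [Matrix.trace, Matrix.mul_apply]
    _ ≤ ∑ a : Fin n, ∑ b : Fin n, 1 := by
        refine Finset.sum_le_sum fun a _ => Finset.sum_le_sum fun b _ => ?_
        simp only [SimpleGraph.adjMatrix_apply]
        split_ifs <;> norm_num
    _ = _ := by simp [pow_two]

/-- The indicator that a cyclic sequence of vertices is a closed walk. -/
noncomputable def cyc {V : Type*} {M : ℕ} (w : Fin (M + 1) → V) (G : SimpleGraph V) : ℝ :=
  ∏ k, adjInd G (w k) (w (k + 1))

theorem cyc_mem {V : Type*} {M : ℕ} (w : Fin (M + 1) → V) (G : SimpleGraph V) :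
    cyc w G ∈ Set.Icc (0 : ℝ) 1 := by
  have h : ∀ k, 0 ≤ adjInd G (w k) (w (k + 1)) ∧ adjInd G (w k) (w (k + 1)) ≤ 1 := by
    intro k
    unfold adjInd
    split_ifs <;> norm_num
  exact ⟨Finset.prod_nonneg fun k _ => (h k).1,
    Finset.prod_le_one (fun k _ => (h k).1) fun k _ => (h k).2⟩

open Classical in
theorem sum_eigenvalues_adjMatrix_pow {n : ℕ} (G : SimpleGraph (Fin n)) (M : ℕ) :
    ∑ i, (G.isHermitian_adjMatrix (R := ℝ)).eigenvalues i ^ (M + 1) =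
      ∑ w : Fin (M + 1) → Fin n, cyc w G := by
  rw [sum_eigenvalues_pow, trace_pow_eq_sum_cyclic]
  simp only [cyc, adjInd, SimpleGraph.adjMatrix_apply]

/-- The power sums of the circulant matrix `!![a, b; b, a]`. -/
theorem sum_cyclic_two (a b : ℝ) (M : ℕ) :
    ∑ τ : Fin (M + 1) → Fin 2, ∏ k, (if τ k = τ (k + 1) then a else b) =
      (a + b) ^ (M + 1) + (a - b) ^ (M + 1) := by
  have h := trace_pow_eq_sum_cyclic (fun i j : Fin 2 => if i = j then a else b) M
  rw [← h]
  have key : ∀ m : ℕ, (Matrix.of (fun i j : Fin 2 => if i = j then a else b)) ^ m =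
      Matrix.of (fun i j : Fin 2 => if i = j then ((a + b) ^ m + (a - b) ^ m) / 2
        else ((a + b) ^ m - (a - b) ^ m) / 2) := by
    intro m
    induction m with
    | zero => ext i j; fin_cases i <;> fin_cases j <;> simp
    | succ m ih =>
      rw [pow_succ, ih]
      ext i j
      fin_cases i <;> fin_cases j <;> simp [Matrix.mul_apply, Fin.sum_univ_two] <;> ring
  change (Matrix.of (fun i j : Fin 2 => if i = j then a else b) ^ (M + 1)).trace = _
  rw [key]
  simp only [Matrix.trace, Matrix.diag_apply, Matrix.of_apply, if_true, Fin.sum_univ_two]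
  ring

instance (d : ℕ) : (torusMeasure d).IsAddLeftInvariant := by
  unfold torusMeasure
  have : ∀ i : Fin d, (AddCircle.haarAddCircle : Measure UnitAddCircle).IsAddLeftInvariant :=
    fun _ => inferInstance
  exact Measure.pi.isAddLeftInvariant _

instance (d : ℕ) : (torusMeasure d).IsNegInvariant := by
  unfold torusMeasure
  have : ∀ i : Fin d, (AddCircle.haarAddCircle : Measure UnitAddCircle).IsNegInvariant :=
    fun _ => inferInstance
  exact Measure.pi.isNegInvariant _

/-- The law of independent uniform positions. -/
noncomputable abbrev posMeasure (d : ℕ) (ι : Type*) [Fintype ι] : Measure (ι → Torus d) :=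
  Measure.pi fun _ : ι => torusMeasure d

theorem measurable_path {d M : ℕ} {h : Fin M → Torus d → ℂ} (hm : ∀ k, Measurable (h k)) :
    Measurable fun y : Fin (M + 1) → Torus d => ∏ k : Fin M, h k (y k.castSucc - y k.succ) :=
  Finset.measurable_prod _ fun k _ =>
    (hm k).comp ((measurable_pi_apply _).sub (measurable_pi_apply _))

theorem norm_path_le {d M : ℕ} {h : Fin M → Torus d → ℂ} (hb : ∀ k x, ‖h k x‖ ≤ 1)
    (y : Fin (M + 1) → Torus d) : ‖∏ k : Fin M, h k (y k.castSucc - y k.succ)‖ ≤ 1 := by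
  rw [norm_prod]
  exact Finset.prod_le_one (fun _ _ => norm_nonneg _) fun k _ => hb k _

theorem integral_path {d : ℕ} : ∀ (M : ℕ) (h : Fin M → Torus d → ℂ) (_ : ∀ k, Measurable (h k))
    (_ : ∀ k x, ‖h k x‖ ≤ 1),
    ∫ y : Fin (M + 1) → Torus d, ∏ k : Fin M, h k (y k.castSucc - y k.succ)
      ∂posMeasure d (Fin (M + 1)) = ∏ k, ∫ x, h k x ∂torusMeasure d
  | 0, h, _, _ => by simp
  | M + 1, h, hm, hb => by
    have hmp := measurePreserving_piFinSuccAbove (fun _ : Fin (M + 2) => torusMeasure d) 0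
    have e : ∀ y : Fin (M + 2) → Torus d, ∏ k : Fin (M + 1), h k (y k.castSucc - y k.succ) =
        (fun q : Torus d × (Fin (M + 1) → Torus d) => h 0 (q.1 - q.2 0) *
          ∏ k : Fin M, h k.succ (q.2 k.castSucc - q.2 k.succ))
        (MeasurableEquiv.piFinSuccAbove (fun _ => Torus d) 0 y) := by
      intro y
      rw [Fin.prod_univ_succ]
      simp [MeasurableEquiv.piFinSuccAbove, Fin.insertNthEquiv, Fin.tail]
    refine (integral_congr_ae (Eventually.of_forall e)).trans ?_
    refine (hmp.integral_comp (MeasurableEquiv.measurableEmbedding _)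
      fun q : Torus d × (Fin (M + 1) → Torus d) => h 0 (q.1 - q.2 0) *
          ∏ k : Fin M, h k.succ (q.2 k.castSucc - q.2 k.succ)).trans ?_
    rw [integral_prod_symm]
    · simp only [integral_mul_const, integral_sub_right_eq_self]
      rw [integral_const_mul, integral_path M (fun k => h k.succ) (fun k => hm _) fun k => hb _,
        Fin.prod_univ_succ]
    · refine Integrable.of_bound (C := 1) (Measurable.aestronglyMeasurable ?_)
        (Eventually.of_forall fun q => ?_)
      · have hr := measurable_path (h := fun k : Fin M => h k.succ) fun k => hm k.succ
        refine Measurable.mul ((hm 0).comp ?_) (hr.comp measurable_snd)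
        exact measurable_fst.sub ((measurable_pi_apply _).comp measurable_snd)
      · rw [norm_mul]
        exact mul_le_one₀ (hb _ _) (norm_nonneg _)
          (norm_path_le (h := fun k => h k.succ) (fun k => hb _) q.2)

theorem measurePreserving_last_sub_zero (d M : ℕ) :
    MeasurePreserving (fun y : Fin (M + 2) → Torus d => y (Fin.last _) - y 0)
      (posMeasure d (Fin (M + 2))) (torusMeasure d) := by
  have h1 := measurePreserving_piFinSuccAbove (fun _ : Fin (M + 2) => torusMeasure d) 0
  have h2 := Measure.measurePreserving_swap (μ := torusMeasure d)
    (ν := posMeasure d (Fin (M + 1)))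
  have h3 : MeasurePreserving (fun p : (Fin (M + 1) → Torus d) × Torus d =>
      (id p.1, p.1 (Fin.last _) - p.2)) ((posMeasure d (Fin (M + 1))).prod (torusMeasure d))
      ((posMeasure d (Fin (M + 1))).prod (torusMeasure d)) := by
    refine (MeasurePreserving.id _).skew_product (g := fun (y : Fin (M + 1) → Torus d) t => y (Fin.last _) - t) ?_ ?_
    · exact ((measurable_pi_apply _).comp measurable_fst).sub measurable_snd
    · exact Eventually.of_forall fun y => (Measure.measurePreserving_sub_left (torusMeasure d) _).map_eq
  have h4 := measurePreserving_snd (μ := posMeasure d (Fin (M + 1))) (ν := torusMeasure d)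
  exact h4.comp (h3.comp (h2.comp h1))

theorem mFourier_add_apply {d : ℕ} (k : Fin d → ℤ) (x y : Torus d) :
    UnitAddTorus.mFourier k (x + y) = UnitAddTorus.mFourier k x * UnitAddTorus.mFourier k y := by
  simp [UnitAddTorus.mFourier, fourier_apply, AddCircle.toCircle_add, Finset.prod_mul_distrib]

theorem mFourier_neg_apply {d : ℕ} (k : Fin d → ℤ) (x : Torus d) :
    UnitAddTorus.mFourier (-k) x = UnitAddTorus.mFourier k (-x) := by
  simp [UnitAddTorus.mFourier, fourier_apply]

theorem mFourier_telescope {d : ℕ} (k : Fin d → ℤ) : ∀ (M : ℕ) (y : Fin (M + 1) → Torus d),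
    ∏ j : Fin M, UnitAddTorus.mFourier (-k) (y j.castSucc - y j.succ) =
      UnitAddTorus.mFourier k (y (Fin.last M) - y 0)
  | 0, y => by simp [UnitAddTorus.mFourier]
  | M + 1, y => by
    rw [Fin.prod_univ_castSucc]
    have := mFourier_telescope k M fun j => y j.castSucc
    simp only [← Fin.succ_castSucc] at this ⊢
    rw [Fin.castSucc_zero] at this
    rw [this, mFourier_neg_apply, ← mFourier_add_apply, Fin.succ_last]
    congr 1
    abel

/-- The integral of a cyclic product is the sum over frequencies of the products of Fourier
coefficients. -/
theorem hasSum_integral_cyclic {d : ℕ} (M : ℕ) (f : Fin (M + 2) → Torus d → ℂ)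
    (hm : ∀ k, Measurable (f k)) (hb : ∀ k x, ‖f k x‖ ≤ 1) :
    HasSum (fun k : Fin d → ℤ => ∏ j, UnitAddTorus.mFourierCoeff (f j) k)
      (∫ y, ∏ j, f j (y j - y (j + 1)) ∂posMeasure d (Fin (M + 2))) := by
  have hL : MemLp (f (Fin.last _)) 2 (torusMeasure d) :=
    MemLp.of_bound (hm _).aestronglyMeasurable 1 (Eventually.of_forall (hb _))
  set p : (Fin (M + 2) → Torus d) → ℂ := fun y =>
    ∏ k : Fin (M + 1), f k.castSucc (y k.castSucc - y k.succ) with hp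
  have hpm : Measurable p := measurable_path fun k => hm k.castSucc
  have hpb : ∀ y, ‖p y‖ ≤ 1 := norm_path_le (h := fun k => f k.castSucc) fun k => hb _
  have hP : MemLp (fun y => starRingEnd ℂ (p y)) 2 (posMeasure d (Fin (M + 2))) :=
    MemLp.of_bound (Complex.continuous_conj.measurable.comp hpm).aestronglyMeasurable 1
      (Eventually.of_forall fun y => by simpa using hpb y)
  have hδ := measurePreserving_last_sub_zero d M
  set Λ : Lp ℂ 2 (torusMeasure d) →L[ℂ] ℂ := (innerSL ℂ (hP.toLp _)).comp
    (Lp.compMeasurePreservingₗᵢ ℂ _ hδ).toContinuousLinearMap with hΛ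
  have hΛa : ∀ (φ : Lp ℂ 2 (torusMeasure d)) (g : Torus d → ℂ), φ =ᵐ[torusMeasure d] g →
      Λ φ = ∫ y, p y * g (y (Fin.last _) - y 0) ∂posMeasure d (Fin (M + 2)) := by
    intro φ g hg
    simp only [hΛ, ContinuousLinearMap.comp_apply, innerSL_apply_apply, L2.inner_def]
    refine integral_congr_ae ?_
    filter_upwards [hP.coeFn_toLp, Lp.coeFn_compMeasurePreserving φ hδ,
      hδ.quasiMeasurePreserving.ae hg] with y h1 h2 h3
    rw [h1]
    erw [h2]
    simp only [RCLike.inner_apply, Complex.conj_conj, Function.comp]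
    rw [h3, mul_comm]
  obtain ⟨E, hE, hsum⟩ : ∃ E : (Fin d → ℤ) → Lp ℂ 2 (torusMeasure d),
      (∀ k, E k =ᵐ[torusMeasure d] UnitAddTorus.mFourier k) ∧
      HasSum (fun k => UnitAddTorus.mFourierCoeff (hL.toLp _) k • E k) (hL.toLp _) :=
    ⟨fun k => UnitAddTorus.mFourierLp 2 k, fun k => UnitAddTorus.coeFn_mFourierLp 2 k,
      UnitAddTorus.hasSum_mFourier_series_L2 (hL.toLp _)⟩
  have h := hsum.mapL Λ
  rw [hΛa _ _ hL.coeFn_toLp] at h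
  convert h using 1
  · funext k
    rw [map_smul, hΛa _ _ (hE k), Fin.prod_univ_castSucc, smul_eq_mul,
      mul_comm]
    congr 1
    · exact integral_congr_ae ((Filter.EventuallyEq.refl _ _).smul hL.coeFn_toLp.symm)
    · simp only [← mFourier_telescope, hp, ← Finset.prod_mul_distrib]
      rw [integral_path (M + 1)
        (fun j x => f j.castSucc x * UnitAddTorus.mFourier (-k) x)]
      · refine Finset.prod_congr rfl fun j _ => ?_
        refine integral_congr_ae (Eventually.of_forall fun x => ?_)
        exact mul_comm _ _
      · exact fun j => (hm _).mul (UnitAddTorus.mFourier (-k)).continuous.measurable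
      · intro j x
        rw [norm_mul]
        refine mul_le_one₀ (hb _ _) (norm_nonneg _) ?_
        exact ((UnitAddTorus.mFourier (-k)).norm_coe_le_norm x).trans_eq
          UnitAddTorus.mFourier_norm
  · refine integral_congr_ae (Eventually.of_forall fun y => ?_)
    exact prod_cyclic (M + 1) (fun j a b => f j (a - b)) y

theorem measurePreserving_comp_injective (d : ℕ) {ι κ : Type*} [Fintype ι] [Fintype κ] {w : κ → ι}
    (hw : Function.Injective w) :
    MeasurePreserving (fun (x : ι → Torus d) k => x (w k)) (posMeasure d ι) (posMeasure d κ) := by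
  refine ⟨measurable_pi_lambda _ fun k => measurable_pi_apply _, ?_⟩
  have h : iIndepFun (fun (i : ι) (x : ι → Torus d) => x i) (posMeasure d ι) :=
    iIndepFun_pi (X := fun _ x => x) fun _ => aemeasurable_id
  have h2 := (iIndepFun_iff_map_fun_eq_pi_map
    (fun k => (measurable_pi_apply (w k)).aemeasurable)).1 (h.precomp hw)
  refine h2.trans ?_
  congr 1
  funext k
  exact (measurePreserving_eval (fun _ : ι => torusMeasure d) (w k)).map_eq

/-- Two bounded functions of the positions, one of them translation invariant, are uncorrelated if
they involve at most one common vertex. -/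
theorem integral_mul_of_translation_invariant {d : ℕ} {ι κ κ' : Type*} [Fintype ι] [Fintype κ]
    [Fintype κ'] [DecidableEq κ'] (w : κ → ι) (w' : κ' → ι) (hw' : Function.Injective w')
    (j₀ : κ') (hj : ∀ j ≠ j₀, w' j ∉ Set.range w)
    {g : (κ → Torus d) → ℝ} {g' : (κ' → Torus d) → ℝ} (hg : Measurable g) (hg' : Measurable g')
    (hgb : ∀ y, |g y| ≤ 1) (hgb' : ∀ y, |g' y| ≤ 1)
    (hinv : ∀ y t, g' (fun j => y j + t) = g' y) :
    ∫ x, g (fun k => x (w k)) * g' (fun k => x (w' k)) ∂posMeasure d ι =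
      (∫ x, g (fun k => x (w k)) ∂posMeasure d ι) *
        ∫ x, g' (fun k => x (w' k)) ∂posMeasure d ι := by
  classical
  set p : ι → Prop := fun i => ∃ j ≠ j₀, w' j = i with hp
  have hpw : ∀ k, ¬ p (w k) := fun k ⟨j, h1, h2⟩ => hj j h1 ⟨k, h2.symm⟩
  have hpj : ¬ p (w' j₀) := fun ⟨j, h1, h2⟩ => h1 (hw' h2)
  have hpj' : ∀ j, j ≠ j₀ → p (w' j) := fun j h => ⟨j, h, rfl⟩
  have hmp := measurePreserving_piEquivPiSubtypeProd (fun _ : ι => torusMeasure d) p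
  set c : ℝ := ∫ b, g' (fun j => if h : j = j₀ then 0 else b ⟨w' j, hpj' j h⟩)
    ∂posMeasure d {i // p i} with hc
  have key : ∀ f : (κ → Torus d) → ℝ, Measurable f → (∀ y, |f y| ≤ 1) →
      ∫ x, f (fun k => x (w k)) * g' (fun k => x (w' k)) ∂posMeasure d ι =
      (∫ a, f (fun k => a ⟨w k, hpw k⟩) ∂posMeasure d {i // ¬ p i}) * c := by
    intro f hf hfb
    have hmeas : Measurable fun q : ({i // p i} → Torus d) × ({i // ¬ p i} → Torus d) =>
        fun j => if h : j = j₀ then q.2 ⟨w' j₀, hpj⟩ else q.1 ⟨w' j, hpj' j h⟩ := by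
      refine measurable_pi_lambda _ fun j => ?_
      split_ifs
      · exact (measurable_pi_apply _).comp measurable_snd
      · exact (measurable_pi_apply _).comp measurable_fst
    refine Eq.trans (integral_congr_ae (Eventually.of_forall fun x => ?_)) <|
      (hmp.integral_comp (MeasurableEquiv.measurableEmbedding _)
        fun q : ({i // p i} → Torus d) × ({i // ¬ p i} → Torus d) =>
          f (fun k => q.2 ⟨w k, hpw k⟩) *
          g' (fun j => if h : j = j₀ then q.2 ⟨w' j₀, hpj⟩ else q.1 ⟨w' j, hpj' j h⟩)).trans ?_
    · simp only [MeasurableEquiv.piEquivPiSubtypeProd, Equiv.piEquivPiSubtypeProd,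
        MeasurableEquiv.coe_mk, Equiv.coe_fn_mk]
      congr 2
      funext j
      split_ifs with h
      · rw [h]
      · rfl
    · rw [integral_prod_symm, ← integral_mul_const]
      · refine integral_congr_ae (Eventually.of_forall fun a => ?_)
        simp only
        rw [integral_const_mul, hc,
          ← integral_add_right_eq_self (μ := posMeasure d {i // p i}) _
            (fun _ => a ⟨w' j₀, hpj⟩)]
        congr 1
        refine integral_congr_ae (Eventually.of_forall fun b => ?_)
        refine Eq.trans (congrArg g' (funext fun j => ?_)) (hinv _ (a ⟨w' j₀, hpj⟩))
        split_ifs with h <;> simp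
      · refine Integrable.of_bound (C := 1) (Measurable.aestronglyMeasurable ?_)
          (Eventually.of_forall fun q => ?_)
        · refine Measurable.mul (hf.comp (measurable_pi_lambda _ fun k => ?_)) (hg'.comp hmeas)
          exact (measurable_pi_apply _).comp measurable_snd
        · rw [norm_mul]
          exact mul_le_one₀ (hfb _) (norm_nonneg _) (hgb' _)
  have h1 := key (fun _ => 1) measurable_const (by simp)
  have h2 : ∫ x, g (fun k => x (w k)) ∂posMeasure d ι =
      ∫ a, g (fun k => a ⟨w k, hpw k⟩) ∂posMeasure d {i // ¬ p i} := by
    have := measurePreserving_comp_injective d (w := fun i : {i // ¬ p i} => i.1)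
      Subtype.val_injective
    rw [← this.map_eq, integral_map this.measurable.aemeasurable]
    refine Measurable.aestronglyMeasurable (hg.comp ?_)
    exact measurable_pi_lambda _ fun k => measurable_pi_apply _
  rw [key g hg hgb, h2]
  simp only [one_mul, integral_const, probReal_univ, smul_eq_mul] at h1
  rw [h1]

/-- The product of the edge probabilities along a closed walk. -/
noncomputable def cycProb {d M : ℕ} (fIn fOut : Torus d → ℝ) (τ : Fin (M + 1) → Fin 2)
    (y : Fin (M + 1) → Torus d) : ℝ :=
  ∏ k, edgeProb fIn fOut (y k - y (k + 1)) (τ k) (τ (k + 1))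

/-- The probability that a closed walk through distinct vertices with given labels is present. -/
noncomputable def cycMean {d M : ℕ} (fIn fOut : Torus d → ℝ) (τ : Fin (M + 1) → Fin 2) : ℝ :=
  ∫ y, cycProb fIn fOut τ y ∂posMeasure d (Fin (M + 1))

section

variable {d : ℕ} {fIn fOut : Torus d → ℝ} (hIn : IsConnectivityFunction fIn)
  (hOut : IsConnectivityFunction fOut)

include hIn hOut

theorem measurable_cycProb {M : ℕ} (τ : Fin (M + 1) → Fin 2) :
    Measurable (cycProb fIn fOut τ) :=
  Finset.measurable_prod _ fun _ _ => (measurable_edgeProb hIn hOut _ _).comp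
    ((measurable_pi_apply _).sub (measurable_pi_apply _))

theorem cycProb_mem {M : ℕ} (τ : Fin (M + 1) → Fin 2) (y : Fin (M + 1) → Torus d) :
    cycProb fIn fOut τ y ∈ Set.Icc (0 : ℝ) 1 :=
  ⟨Finset.prod_nonneg fun _ _ => (edgeProb_mem hIn hOut _ _ _).1,
    Finset.prod_le_one (fun _ _ => (edgeProb_mem hIn hOut _ _ _).1)
      fun _ _ => (edgeProb_mem hIn hOut _ _ _).2⟩

theorem abs_cycProb_le {M : ℕ} (τ : Fin (M + 1) → Fin 2) (y : Fin (M + 1) → Torus d) :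
    |cycProb fIn fOut τ y| ≤ 1 := by
  have := cycProb_mem hIn hOut τ y
  rw [abs_of_nonneg this.1]
  exact this.2

theorem cycMean_mem {M : ℕ} (τ : Fin (M + 1) → Fin 2) :
    cycMean fIn fOut τ ∈ Set.Icc (0 : ℝ) 1 := by
  refine ⟨integral_nonneg fun y => (cycProb_mem hIn hOut τ y).1, ?_⟩
  have := norm_integral_le_of_norm_le_const (μ := posMeasure d (Fin (M + 1)))
    (f := cycProb fIn fOut τ) (C := 1)
    (Eventually.of_forall (abs_cycProb_le hIn hOut τ))
  rw [probReal_univ, mul_one] at this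
  exact (le_abs_self _).trans this

end

theorem cycProb_add {d M : ℕ} (fIn fOut : Torus d → ℝ) (τ : Fin (M + 1) → Fin 2)
    (y : Fin (M + 1) → Torus d) (t : Torus d) :
    cycProb fIn fOut τ (fun k => y k + t) = cycProb fIn fOut τ y := by
  simp [cycProb]

/-- The probability of a graph given the labels. -/
noncomputable def margProb {d n : ℕ} (fIn fOut : Torus d → ℝ) (s : Fin n → Fin 2)
    (G : SimpleGraph (Fin n)) : ℝ :=
  ∫ x, graphProb fIn fOut s x G ∂posMeasure d (Fin n)

theorem sym2_cyclic_injective {V : Type*} {M : ℕ} (hM : 2 ≤ M) {w : Fin (M + 1) → V}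
    (hw : Function.Injective w) : Function.Injective fun k => s(w k, w (k + 1)) := by
  intro k l h
  rcases Sym2.eq_iff.1 h with ⟨h1, _⟩ | ⟨h1, h2⟩
  · exact hw h1
  · have h3 := hw h1
    have h4 := hw h2
    rw [h3, add_assoc, add_eq_left] at h4
    have : ((1 : Fin (M + 1)) + 1).val = 2 := by
      rw [Fin.val_add, Fin.val_one', Nat.mod_eq_of_lt (by omega : 1 < M + 1),
        Nat.mod_eq_of_lt (by omega)]
    rw [h4] at this
    simp at this

theorem add_one_ne {M : ℕ} (hM : 2 ≤ M) (k : Fin (M + 1)) : k + 1 ≠ k := by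
  intro h
  rw [add_eq_left] at h
  have : (1 : Fin (M + 1)).val = 1 := by
    rw [Fin.val_one', Nat.mod_eq_of_lt (by omega : 1 < M + 1)]
  rw [h] at this
  simp at this

section

variable {d : ℕ} {fIn fOut : Torus d → ℝ} (hIn : IsConnectivityFunction fIn)
  (hOut : IsConnectivityFunction fOut)

include hIn hOut

theorem margProb_nonneg {n : ℕ} (s : Fin n → Fin 2) (G : SimpleGraph (Fin n)) :
    0 ≤ margProb fIn fOut s G :=
  integral_nonneg fun x => graphProb_nonneg hIn hOut s x G

theorem integrable_graphProb {n : ℕ} (s : Fin n → Fin 2) (G : SimpleGraph (Fin n)) :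
    Integrable (fun x => graphProb fIn fOut s x G) (posMeasure d (Fin n)) := by
  refine Integrable.of_bound (C := 1) (measurable_graphProb hIn hOut s G).aestronglyMeasurable
    (Eventually.of_forall fun x => ?_)
  rw [Real.norm_of_nonneg (graphProb_nonneg hIn hOut s x G)]
  exact graphProb_le_one hIn hOut s x G

theorem sum_margProb_mul {n : ℕ} (s : Fin n → Fin 2) (h : SimpleGraph (Fin n) → ℝ) :
    ∑ G, margProb fIn fOut s G * h G =
      ∫ x, ∑ G, graphProb fIn fOut s x G * h G ∂posMeasure d (Fin n) := by
  rw [integral_finsetSum _ fun G _ => (integrable_graphProb hIn hOut s G).mul_const _]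
  simp only [integral_mul_const, margProb]

theorem sum_margProb {n : ℕ} (s : Fin n → Fin 2) : ∑ G, margProb fIn fOut s G = 1 := by
  have := sum_margProb_mul hIn hOut s fun _ => 1
  simpa [sum_graphProb hIn hOut] using this

theorem cycMean_comp {n M : ℕ} (s : Fin n → Fin 2) {w : Fin (M + 1) → Fin n}
    (hw : Function.Injective w) : cycMean fIn fOut (s ∘ w) =
      ∫ x, cycProb fIn fOut (s ∘ w) (fun k => x (w k)) ∂posMeasure d (Fin n) := by
  have hmp := measurePreserving_comp_injective d hw
  rw [cycMean, ← hmp.map_eq, integral_map hmp.measurable.aemeasurable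
    (measurable_cycProb hIn hOut _).aestronglyMeasurable]

theorem sum_margProb_mul_cyc {n M : ℕ} (hM : 2 ≤ M) (s : Fin n → Fin 2)
    {w : Fin (M + 1) → Fin n} (hw : Function.Injective w) :
    ∑ G, margProb fIn fOut s G * cyc w G = cycMean fIn fOut (s ∘ w) := by
  rw [sum_margProb_mul hIn hOut, cycMean_comp hIn hOut s hw]
  refine integral_congr_ae (Eventually.of_forall fun x => ?_)
  exact sum_graphProb_mul_prod_adjInd hIn hOut s x w (fun k => w (k + 1))
    (fun k h => add_one_ne hM k (hw h).symm) (sym2_cyclic_injective hM hw)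

theorem sum_margProb_mul_cyc_mul_cyc {n M : ℕ} (hM : 2 ≤ M) (s : Fin n → Fin 2)
    {w w' : Fin (M + 1) → Fin n} (hw : Function.Injective w) (hw' : Function.Injective w')
    (j₀ : Fin (M + 1)) (hj : ∀ j ≠ j₀, w' j ∉ Set.range w) :
    ∑ G, margProb fIn fOut s G * (cyc w G * cyc w' G) =
      cycMean fIn fOut (s ∘ w) * cycMean fIn fOut (s ∘ w') := by
  rw [sum_margProb_mul hIn hOut, cycMean_comp hIn hOut s hw, cycMean_comp hIn hOut s hw',
    ← integral_mul_of_translation_invariant w w' hw' j₀ hj (measurable_cycProb hIn hOut _)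
    (measurable_cycProb hIn hOut _) (abs_cycProb_le hIn hOut _) (abs_cycProb_le hIn hOut _)
    (fun y t => cycProb_add fIn fOut _ y t)]
  refine integral_congr_ae (Eventually.of_forall fun x => ?_)
  have h := sum_graphProb_mul_prod_adjInd hIn hOut s x
    (ι := Fin (M + 1) ⊕ Fin (M + 1)) (Sum.elim w w')
    (Sum.elim (fun k => w (k + 1)) (fun k => w' (k + 1))) ?_ ?_
  · simp only [Fintype.prod_sum_type, Sum.elim_inl, Sum.elim_inr] at h
    exact h
  · rintro (k | k) h
    · exact add_one_ne hM k (hw h).symm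
    · exact add_one_ne hM k (hw' h).symm
  · have hne : ∀ k l, s(w k, w (k + 1)) ≠ s(w' l, w' (l + 1)) := by
      intro k l h
      have hmem : ∀ v, v ∈ s(w' l, w' (l + 1)) → v ∈ Set.range w := by
        intro v hv
        rw [← h, Sym2.mem_iff] at hv
        rcases hv with rfl | rfl <;> exact ⟨_, rfl⟩
      by_cases hl : l = j₀
      · exact hj (l + 1) (fun h' => add_one_ne hM l (h'.trans hl.symm))
          (hmem _ (Sym2.mem_mk_right _ _))
      · exact hj l hl (hmem _ (Sym2.mem_mk_left _ _))
    rintro (k | k) (l | l) h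
    · exact congrArg Sum.inl (sym2_cyclic_injective hM hw h)
    · exact absurd h (hne k l)
    · exact absurd h.symm (hne l k)
    · exact congrArg Sum.inr (sym2_cyclic_injective hM hw' h)

end

theorem card_two_values {m n : ℕ} {j j' : Fin m} (hj : j ≠ j') (a b : Fin n) :
    n ^ 2 * (Finset.univ.filter fun w : Fin m → Fin n => w j = a ∧ w j' = b).card = n ^ m := by
  have h1 : (Finset.univ.filter fun w : Fin m → Fin n => w j = a ∧ w j' = b) =
      Fintype.piFinset fun k => if k = j then {a} else if k = j' then {b} else Finset.univ := by
    ext w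
    simp only [Finset.mem_filter, Finset.mem_univ, true_and, Fintype.mem_piFinset]
    constructor
    · rintro ⟨h1, h2⟩ k
      split_ifs with h3 h4
      · simp [h3, h1]
      · simp [h4, h2]
      · simp
    · intro h
      have h2 := h j
      have h3 := h j'
      simp only [if_true, hj.symm, if_false, Finset.mem_singleton] at h2 h3
      exact ⟨h2, h3⟩
  have h2 : n ^ 2 = ∏ k : Fin m, if k ∈ ({j, j'} : Finset (Fin m)) then n else 1 := by
    rw [Finset.prod_ite_mem, Finset.univ_inter, Finset.prod_const, Finset.card_pair hj]
  rw [h1, Fintype.card_piFinset, h2, ← Finset.prod_mul_distrib]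
  calc _ = ∏ _k : Fin m, n := by
        refine Finset.prod_congr rfl fun k _ => ?_
        by_cases h3 : k = j
        · simp [h3]
        · by_cases h4 : k = j' <;> simp [h3, h4, hj.symm]
    _ = n ^ m := by simp

open Classical in
theorem card_not_injective_le (m n : ℕ) :
    n * (Finset.univ.filter fun w : Fin m → Fin n => ¬ Function.Injective w).card ≤
      m ^ 2 * n ^ m := by
  rcases Nat.eq_zero_or_pos n with rfl | hn
  · simp
  refine Nat.le_of_mul_le_mul_left ?_ hn
  have hsub : (Finset.univ.filter fun w : Fin m → Fin n => ¬ Function.Injective w) ⊆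
      (Finset.univ.filter fun q : Fin m × Fin m => q.1 ≠ q.2).biUnion fun q =>
        (Finset.univ : Finset (Fin n)).biUnion fun a =>
          Finset.univ.filter fun w : Fin m → Fin n => w q.1 = a ∧ w q.2 = a := by
    intro w hw
    simp only [Finset.mem_filter, Finset.mem_univ, true_and, Function.Injective, not_forall] at hw
    obtain ⟨j, j', h1, h2⟩ := hw
    simp only [Finset.mem_biUnion, Finset.mem_filter, Finset.mem_univ, true_and]
    exact ⟨(j, j'), h2, w j, rfl, h1.symm⟩
  calc _ = n ^ 2 * _ := by rw [pow_two, mul_assoc]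
    _ ≤ n ^ 2 * ∑ q : Fin m × Fin m with q.1 ≠ q.2, ∑ a : Fin n,
        (Finset.univ.filter fun w : Fin m → Fin n => w q.1 = a ∧ w q.2 = a).card :=
      Nat.mul_le_mul_left _ ((Finset.card_le_card hsub).trans (Finset.card_biUnion_le.trans
        (Finset.sum_le_sum fun q _ => Finset.card_biUnion_le)))
    _ = ∑ q : Fin m × Fin m with q.1 ≠ q.2, n * n ^ m := by
      rw [Finset.mul_sum]
      refine Finset.sum_congr rfl fun q hq => ?_
      rw [Finset.mul_sum, Finset.sum_congr rfl fun a _ =>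
        card_two_values (Finset.mem_filter.1 hq).2 a a]
      simp
    _ ≤ ∑ q : Fin m × Fin m, n * n ^ m :=
      Finset.sum_le_sum_of_subset (Finset.filter_subset _ _)
    _ = _ := by simp; ring

/-- Two cyclic sequences of vertices having (at least) two positions of the second one in common. -/
def Overlap {m n : ℕ} (w w' : Fin m → Fin n) : Prop :=
  ∃ j j' i i', j ≠ j' ∧ w' j = w i ∧ w' j' = w i'

theorem exists_of_not_overlap {M n : ℕ} {w w' : Fin (M + 1) → Fin n} (h : ¬ Overlap w w') :
    ∃ j₀, ∀ j ≠ j₀, w' j ∉ Set.range w := by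
  by_contra! hc
  obtain ⟨j, _, i, hi⟩ := hc 0
  obtain ⟨j', hj, i', hi'⟩ := hc j
  exact h ⟨j, j', i, i', hj.symm, hi.symm, hi'.symm⟩

open Classical in
theorem card_overlap_le (m n : ℕ) :
    n ^ 2 * (Finset.univ.filter fun q : (Fin m → Fin n) × (Fin m → Fin n) =>
      Overlap q.1 q.2).card ≤ m ^ 4 * (n ^ m) ^ 2 := by
  have hsub : (Finset.univ.filter fun q : (Fin m → Fin n) × (Fin m → Fin n) => Overlap q.1 q.2) ⊆
      (Finset.univ.filter fun q : (Fin m × Fin m) × (Fin m × Fin m) => q.1.1 ≠ q.1.2).biUnion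
        fun q => (Finset.univ : Finset (Fin m → Fin n)).biUnion fun w =>
          (Finset.univ.filter fun w' : Fin m → Fin n =>
            w' q.1.1 = w q.2.1 ∧ w' q.1.2 = w q.2.2).image fun w' => (w, w') := by
    rintro ⟨w, w'⟩ hw
    obtain ⟨j, j', i, i', h1, h2, h3⟩ := (Finset.mem_filter.1 hw).2
    simp only [Finset.mem_biUnion, Finset.mem_filter, Finset.mem_univ, true_and, Finset.mem_image]
    exact ⟨((j, j'), (i, i')), h1, w, w', ⟨h2, h3⟩, rfl⟩
  calc _ ≤ n ^ 2 * ∑ q : (Fin m × Fin m) × (Fin m × Fin m) with q.1.1 ≠ q.1.2,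
        ∑ w : Fin m → Fin n, (Finset.univ.filter fun w' : Fin m → Fin n =>
          w' q.1.1 = w q.2.1 ∧ w' q.1.2 = w q.2.2).card :=
      Nat.mul_le_mul_left _ ((Finset.card_le_card hsub).trans (Finset.card_biUnion_le.trans
        (Finset.sum_le_sum fun q _ => Finset.card_biUnion_le.trans
          (Finset.sum_le_sum fun w _ => Finset.card_image_le))))
    _ = ∑ q : (Fin m × Fin m) × (Fin m × Fin m) with q.1.1 ≠ q.1.2, (n ^ m) ^ 2 := by
      rw [Finset.mul_sum]
      refine Finset.sum_congr rfl fun q hq => ?_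
      rw [Finset.mul_sum, Finset.sum_congr rfl fun w _ =>
        card_two_values (Finset.mem_filter.1 hq).2 _ _]
      simp [pow_two (n ^ m)]
    _ ≤ ∑ q : (Fin m × Fin m) × (Fin m × Fin m), (n ^ m) ^ 2 :=
      Finset.sum_le_sum_of_subset (Finset.filter_subset _ _)
    _ = _ := by
      simp only [Finset.sum_const, Finset.card_univ, Fintype.card_prod, Fintype.card_fin,
        smul_eq_mul]
      ring

theorem sum_comp_labelling {m n N : ℕ} {s : Fin n → Fin 2}
    (hs : ∀ a, (Finset.univ.filter fun i => s i = a).card = N) (F : (Fin m → Fin 2) → ℝ) :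
    ∑ w : Fin m → Fin n, F (s ∘ w) = (N : ℝ) ^ m * ∑ τ, F τ := by
  classical
  rw [← Finset.sum_fiberwise (s := Finset.univ) (g := fun w : Fin m → Fin n => s ∘ w),
    Finset.mul_sum]
  refine Finset.sum_congr rfl fun τ _ => ?_
  have h1 : (Finset.univ.filter fun w : Fin m → Fin n => s ∘ w = τ) =
      Fintype.piFinset fun k => Finset.univ.filter fun i => s i = τ k := by
    ext w
    simp [funext_iff]
  have h2 : (Finset.univ.filter fun w : Fin m → Fin n => s ∘ w = τ).card = N ^ m := by
    rw [h1, Fintype.card_piFinset, Finset.prod_congr rfl fun k _ => hs (τ k)]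
    simp
  rw [Finset.sum_congr rfl (g := fun _ => F τ) fun w hw => by rw [(Finset.mem_filter.1 hw).2],
    Finset.sum_const, h2, nsmul_eq_mul, Nat.cast_pow]

/-- The limit of the moments of the spectral measure. -/
noncomputable def limitMoment {d : ℕ} (fIn fOut : Torus d → ℝ) (M : ℕ) : ℝ :=
  (∑ τ : Fin (M + 1) → Fin 2, cycMean fIn fOut τ) / 2 ^ (M + 1)

section

variable {d : ℕ} {fIn fOut : Torus d → ℝ} (hIn : IsConnectivityFunction fIn)
  (hOut : IsConnectivityFunction fOut)

include hIn hOut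

theorem abs_cyc_sub_cycMean_le {n M : ℕ} (s : Fin n → Fin 2) (w : Fin (M + 1) → Fin n)
    (G : SimpleGraph (Fin n)) : |cyc w G - cycMean fIn fOut (s ∘ w)| ≤ 1 := by
  have h1 := cyc_mem w G
  have h2 := cycMean_mem hIn hOut (s ∘ w)
  rw [abs_le]
  constructor <;> linarith [h1.1, h1.2, h2.1, h2.2]

open Classical in
theorem variance_le {n M : ℕ} (hM : 2 ≤ M) (s : Fin n → Fin 2) :
    ∑ G, margProb fIn fOut s G * (∑ w : Fin (M + 1) → Fin n with Function.Injective w,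
      (cyc w G - cycMean fIn fOut (s ∘ w))) ^ 2 ≤
    ((Finset.univ.filter fun q : (Fin (M + 1) → Fin n) × (Fin (M + 1) → Fin n) =>
      Overlap q.1 q.2).card : ℝ) := by
  set I : Finset (Fin (M + 1) → Fin n) := Finset.univ.filter Function.Injective with hI
  set c : (Fin (M + 1) → Fin n) → ℝ := fun w => cycMean fIn fOut (s ∘ w) with hc
  have hpair : ∀ w ∈ I, ∀ w' ∈ I,
      ∑ G, margProb fIn fOut s G * ((cyc w G - c w) * (cyc w' G - c w')) ≤
        if Overlap w w' then 1 else 0 := by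
    intro w hw w' hw'
    have hw := (Finset.mem_filter.1 hw).2
    have hw' := (Finset.mem_filter.1 hw').2
    split_ifs with h
    · rw [← sum_margProb hIn hOut s]
      refine Finset.sum_le_sum fun G _ => ?_
      refine mul_le_of_le_one_right (margProb_nonneg hIn hOut s G) ?_
      refine (le_abs_self _).trans ?_
      rw [abs_mul]
      exact mul_le_one₀ (abs_cyc_sub_cycMean_le hIn hOut s w G) (abs_nonneg _)
        (abs_cyc_sub_cycMean_le hIn hOut s w' G)
    · obtain ⟨j₀, hj⟩ := exists_of_not_overlap h
      have e : ∀ G, margProb fIn fOut s G * ((cyc w G - c w) * (cyc w' G - c w')) =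
          margProb fIn fOut s G * (cyc w G * cyc w' G) - c w' * (margProb fIn fOut s G * cyc w G)
          - c w * (margProb fIn fOut s G * cyc w' G) + c w * c w' * margProb fIn fOut s G := by
        intro G
        ring
      simp only [e, Finset.sum_add_distrib, Finset.sum_sub_distrib, ← Finset.mul_sum]
      rw [sum_margProb_mul_cyc_mul_cyc hIn hOut hM s hw hw' j₀ hj,
        sum_margProb_mul_cyc hIn hOut hM s hw, sum_margProb_mul_cyc hIn hOut hM s hw',
        sum_margProb hIn hOut]
      simp only [hc]
      apply le_of_eq
      ring
  calc _ = ∑ w ∈ I, ∑ w' ∈ I,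
        ∑ G, margProb fIn fOut s G * ((cyc w G - c w) * (cyc w' G - c w')) := by
        simp only [pow_two, Finset.sum_mul_sum]
        simp only [Finset.mul_sum]
        rw [Finset.sum_comm]
        exact Finset.sum_congr rfl fun w _ => Finset.sum_comm
    _ ≤ ∑ w ∈ I, ∑ w' ∈ I, if Overlap w w' then 1 else 0 :=
        Finset.sum_le_sum fun w hw => Finset.sum_le_sum fun w' hw' => hpair w hw w' hw'
    _ ≤ ∑ w, ∑ w', if Overlap w w' then 1 else 0 := by
        have h0 : ∀ w w' : Fin (M + 1) → Fin n, (0 : ℝ) ≤ if Overlap w w' then 1 else 0 := by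
          intro w w'
          split_ifs <;> norm_num
        refine (Finset.sum_le_sum fun w _ => Finset.sum_le_sum_of_subset_of_nonneg
          (Finset.subset_univ I) fun w' _ _ => h0 w w').trans ?_
        exact Finset.sum_le_sum_of_subset_of_nonneg (Finset.subset_univ I)
          fun w _ _ => Finset.sum_nonneg fun w' _ => h0 w w'
    _ = _ := by
        rw [← Fintype.sum_prod_type' (f := fun w w' => if Overlap w w' then (1 : ℝ) else 0)]
        simp

/-- The normalized number of closed walks has mean square distance `O(n⁻²)` to its limit. -/
theorem second_moment_le {n N M : ℕ} (hn : n = 2 * N) (hN : 0 < N) (hM : 2 ≤ M)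
    {s : Fin n → Fin 2} (hs : ∀ a, (Finset.univ.filter fun i => s i = a).card = N) :
    ∑ G, margProb fIn fOut s G * ((∑ w : Fin (M + 1) → Fin n, cyc w G) /
      (n : ℝ) ^ (M + 1) - limitMoment fIn fOut M) ^ 2 ≤ 4 * ((M + 1 : ℕ) : ℝ) ^ 4 / (n : ℝ) ^ 2 := by
  classical
  have hn0 : (0 : ℝ) < (n : ℝ) := by
    rw [hn]
    exact_mod_cast Nat.mul_pos two_pos hN
  have hnr : (n : ℝ) = 2 * N := by
    rw [hn]
    push_cast
    rfl
  set c : (Fin (M + 1) → Fin n) → ℝ := fun w => cycMean fIn fOut (s ∘ w) with hc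
  set r : ℝ := ((Finset.univ.filter fun w : Fin (M + 1) → Fin n =>
    ¬ Function.Injective w).card : ℝ) with hr
  set b : ℝ := ((Finset.univ.filter fun q : (Fin (M + 1) → Fin n) × (Fin (M + 1) → Fin n) =>
      Overlap q.1 q.2).card : ℝ) with hb
  have hr1 : n * r ≤ ((M + 1 : ℕ) : ℝ) ^ 2 * (n : ℝ) ^ (M + 1) := by
    rw [hr]
    exact_mod_cast card_not_injective_le (M + 1) n
  have hb1 : (n : ℝ) ^ 2 * b ≤ ((M + 1 : ℕ) : ℝ) ^ 4 * ((n : ℝ) ^ (M + 1)) ^ 2 := by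
    rw [hb]
    exact_mod_cast card_overlap_le (M + 1) n
  set A : SimpleGraph (Fin n) → ℝ := fun G =>
    ∑ w : Fin (M + 1) → Fin n with Function.Injective w, (cyc w G - c w) with hA
  have hD : ∀ G : SimpleGraph (Fin n), ((∑ w : Fin (M + 1) → Fin n, cyc w G) /
      (n : ℝ) ^ (M + 1) - limitMoment fIn fOut M) ^ 2 * ((n : ℝ) ^ (M + 1)) ^ 2 ≤
      2 * A G ^ 2 + 2 * r ^ 2 := by
    intro G
    set R : ℝ := ∑ w : Fin (M + 1) → Fin n with ¬ Function.Injective w, (cyc w G - c w) with hR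
    have hRr : |R| ≤ r := by
      refine (Finset.abs_sum_le_sum_abs _ _).trans ?_
      refine (Finset.sum_le_sum fun w _ => abs_cyc_sub_cycMean_le hIn hOut s w G).trans ?_
      simp [hr]
    have hsum : ((∑ w : Fin (M + 1) → Fin n, cyc w G) /
        (n : ℝ) ^ (M + 1) - limitMoment fIn fOut M) * (n : ℝ) ^ (M + 1) = A G + R := by
      rw [hA, hR, Finset.sum_filter_add_sum_filter_not, Finset.sum_sub_distrib, sub_mul,
        div_mul_cancel₀ _ (pow_pos hn0 _).ne', sum_comp_labelling hs (cycMean fIn fOut),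
        limitMoment, hnr, mul_pow]
      field_simp
    rw [← mul_pow, hsum]
    have : R ^ 2 ≤ r ^ 2 := sq_le_sq' (by linarith [abs_le.1 hRr]) (abs_le.1 hRr).2
    nlinarith [sq_nonneg (A G - R)]
  have hfin : (∑ G, margProb fIn fOut s G * ((∑ w : Fin (M + 1) → Fin n, cyc w G) /
      (n : ℝ) ^ (M + 1) - limitMoment fIn fOut M) ^ 2) * ((n : ℝ) ^ (M + 1)) ^ 2 ≤
      2 * b + 2 * r ^ 2 := by
    rw [Finset.sum_mul]
    calc _ ≤ ∑ G, (2 * (margProb fIn fOut s G * A G ^ 2) + 2 * r ^ 2 * margProb fIn fOut s G) := by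
          refine Finset.sum_le_sum fun G _ => ?_
          have := mul_le_mul_of_nonneg_left (hD G) (margProb_nonneg hIn hOut s G)
          linarith
      _ = 2 * ∑ G, margProb fIn fOut s G * A G ^ 2 + 2 * r ^ 2 := by
          rw [Finset.sum_add_distrib, ← Finset.mul_sum, ← Finset.mul_sum, sum_margProb hIn hOut,
            mul_one]
      _ ≤ _ := by
          have := variance_le hIn hOut hM s
          linarith
  have hr2 : (n : ℝ) ^ 2 * r ^ 2 ≤ ((M + 1 : ℕ) : ℝ) ^ 4 * ((n : ℝ) ^ (M + 1)) ^ 2 := by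
    calc (n : ℝ) ^ 2 * r ^ 2 = (n * r) ^ 2 := by ring
      _ ≤ (((M + 1 : ℕ) : ℝ) ^ 2 * (n : ℝ) ^ (M + 1)) ^ 2 :=
        pow_le_pow_left₀ (by positivity) hr1 2
      _ = _ := by ring
  rw [le_div_iff₀ (by positivity)]
  refine le_of_mul_le_mul_right ?_ (by positivity : 0 < ((n : ℝ) ^ (M + 1)) ^ 2)
  nlinarith [mul_le_mul_of_nonneg_right hfin (sq_nonneg (n : ℝ))]

end

theorem hasSum_cycMean {d : ℕ} {fIn fOut : Torus d → ℝ} (hIn : IsConnectivityFunction fIn)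
    (hOut : IsConnectivityFunction fOut) {M : ℕ} (τ : Fin (M + 2) → Fin 2) :
    HasSum (fun k : Fin d → ℤ => ∏ j, if τ j = τ (j + 1) then (fourierHat fIn k).re
      else (fourierHat fOut k).re) (cycMean fIn fOut τ) := by
  have h := hasSum_integral_cyclic M
    (fun j x => (edgeProb fIn fOut (x : Torus d) (τ j) (τ (j + 1)) : ℂ))
    (fun j => Complex.measurable_ofReal.comp (measurable_edgeProb hIn hOut _ _)) (fun j x => by
      have := edgeProb_mem hIn hOut x (τ j) (τ (j + 1))
      rw [Complex.norm_real, Real.norm_of_nonneg this.1]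
      exact this.2)
  have h1 : ∫ y, ∏ j, (edgeProb fIn fOut (y j - y (j + 1) : Torus d) (τ j) (τ (j + 1)) : ℂ)
      ∂posMeasure d (Fin (M + 2)) = (cycMean fIn fOut τ : ℂ) := by
    rw [cycMean, ← integral_complex_ofReal]
    simp only [cycProb, Complex.ofReal_prod]
  rw [h1] at h
  rw [← Complex.hasSum_ofReal]
  convert h using 2 with k
  rw [Complex.ofReal_prod]
  refine Finset.prod_congr rfl fun j _ => ?_
  have hre : ∀ {F : Torus d → ℝ}, IsConnectivityFunction F →
      ((fourierHat F k).re : ℂ) = fourierHat F k := fun hF =>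
    Complex.ext rfl (fourierHat_im hF k).symm
  unfold edgeProb
  split_ifs
  · exact hre hIn
  · exact hre hOut

theorem hasSum_limitMoment {d : ℕ} {fIn fOut : Torus d → ℝ} (hIn : IsConnectivityFunction fIn)
    (hOut : IsConnectivityFunction fOut) (M : ℕ) :
    HasSum (fun k : Fin d → ℤ =>
      (((fourierHat fIn k).re + (fourierHat fOut k).re) / 2) ^ (M + 2) +
      (((fourierHat fIn k).re - (fourierHat fOut k).re) / 2) ^ (M + 2))
      (limitMoment fIn fOut (M + 1)) := by
  have h := (hasSum_sum fun (τ : Fin (M + 2) → Fin 2) (_ : τ ∈ Finset.univ) =>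
    hasSum_cycMean hIn hOut τ).div_const (2 ^ (M + 2))
  simp only [sum_cyclic_two] at h
  simp only [div_pow, ← add_div]
  exact h

theorem abs_re_fourierHat_le {d : ℕ} {F : Torus d → ℝ} (hF : IsConnectivityFunction F)
    (k : Fin d → ℤ) : |(fourierHat F k).re| ≤ 1 := by
  refine (Complex.abs_re_le_norm _).trans ?_
  rw [fourierHat_eq_integral]
  refine (norm_integral_le_of_norm_le_const (C := 1) (Eventually.of_forall fun x => ?_)).trans ?_
  · have h := hF.mem_Icc x
    rw [norm_mul, Complex.norm_real, Real.norm_of_nonneg h.1]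
    exact mul_le_one₀ (((UnitAddTorus.mFourier (-k)).norm_coe_le_norm x).trans_eq
      UnitAddTorus.mFourier_norm) h.1 h.2
  · simp

section

variable {ι : ℕ → Type*} [∀ N, Fintype (ι N)] {κ : Type*} {x : ∀ N, ι N → ℝ} {y : κ → ℝ} {L : ℕ → ℝ}

theorem tendsto_sum_polynomial (hy : ∀ j, HasSum (fun k => y k ^ (j + 4)) (L j))
    (hx : ∀ j, Tendsto (fun N => ∑ i, x N i ^ (j + 4)) atTop (𝓝 (L j))) (p : Polynomial ℝ) :
    ∃ l, HasSum (fun k => p.eval (y k) * y k ^ 4) l ∧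
      Tendsto (fun N => ∑ i, p.eval (x N i) * x N i ^ 4) atTop (𝓝 l) := by
  have e : ∀ t : ℝ, p.eval t * t ^ 4 =
      ∑ j ∈ Finset.range (p.natDegree + 1), p.coeff j * t ^ (j + 4) := by
    intro t
    rw [Polynomial.eval_eq_sum_range, Finset.sum_mul]
    exact Finset.sum_congr rfl fun j _ => by ring
  refine ⟨∑ j ∈ Finset.range (p.natDegree + 1), p.coeff j * L j, ?_, ?_⟩
  · simp only [e]
    exact hasSum_sum fun j _ => (hy j).mul_left _
  · simp only [e]
    have : ∀ N, ∑ i, ∑ j ∈ Finset.range (p.natDegree + 1), p.coeff j * x N i ^ (j + 4) =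
        ∑ j ∈ Finset.range (p.natDegree + 1), p.coeff j * ∑ i, x N i ^ (j + 4) := by
      intro N
      rw [Finset.sum_comm]
      simp only [Finset.mul_sum]
    simp only [this]
    exact tendsto_finsetSum _ fun j _ => (hx j).const_mul _

/-- Convergence of moments implies convergence of integrals of continuous functions, for point
configurations in `[-1, 1]`. -/
theorem tendsto_sum_continuous (hx1 : ∀ N i, |x N i| ≤ 1) (hy1 : ∀ k, |y k| ≤ 1)
    (hy : ∀ j, HasSum (fun k => y k ^ (j + 4)) (L j))
    (hx : ∀ j, Tendsto (fun N => ∑ i, x N i ^ (j + 4)) atTop (𝓝 (L j)))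
    {f : ℝ → ℝ} (hf : Continuous f) :
    ∃ l, HasSum (fun k => f (y k) * y k ^ 4) l ∧
      Tendsto (fun N => ∑ i, f (x N i) * x N i ^ 4) atTop (𝓝 l) := by
  have hy4 : HasSum (fun k => y k ^ 4) (L 0) := by simpa using hy 0
  have hx4 : Tendsto (fun N => ∑ i, x N i ^ 4) atTop (𝓝 (L 0)) := by simpa using hx 0
  have hL0 : 0 ≤ L 0 := hy4.nonneg fun k => by positivity
  have happ : ∀ δ > 0, ∃ p : Polynomial ℝ, ∀ t : ℝ, |t| ≤ 1 →
      |f t * t ^ 4 - p.eval t * t ^ 4| ≤ δ * t ^ 4 := by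
    intro δ hδ
    obtain ⟨p, hp⟩ := exists_polynomial_near_of_continuousOn (-1) 1 f hf.continuousOn δ hδ
    refine ⟨p, fun t ht => ?_⟩
    rw [← sub_mul, abs_mul, abs_of_nonneg (by positivity : 0 ≤ t ^ 4), abs_sub_comm]
    exact mul_le_mul_of_nonneg_right (hp t (abs_le.1 ht)).le (by positivity)
  have hsum : Summable fun k => f (y k) * y k ^ 4 := by
    obtain ⟨p, hp⟩ := happ 1 one_pos
    obtain ⟨l, hl, -⟩ := tendsto_sum_polynomial hy hx p
    have h1 : Summable fun k => f (y k) * y k ^ 4 - p.eval (y k) * y k ^ 4 :=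
      Summable.of_norm_bounded (hy4.summable.mul_left 1) fun k => hp _ (hy1 k)
    exact (h1.add hl.summable).congr fun k => by ring
  refine ⟨_, hsum.hasSum, Metric.tendsto_atTop.2 fun ε hε => ?_⟩
  set δ : ℝ := ε / (4 * (L 0 + 1)) with hδ
  have hδ0 : 0 < δ := by positivity
  have hδL : δ * (L 0 + 1) = ε / 4 := by
    rw [hδ]
    field_simp
  obtain ⟨p, hp⟩ := happ δ hδ0
  obtain ⟨l, hl, htl⟩ := tendsto_sum_polynomial hy hx p
  have h1 : |(∑' k, f (y k) * y k ^ 4) - l| ≤ δ * L 0 := by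
    have h2 := hsum.hasSum.sub hl
    rw [abs_le]
    constructor
    · exact hasSum_le (fun k => (abs_le.1 (hp _ (hy1 k))).1) (hy4.mul_left δ).neg h2
    · exact hasSum_le (fun k => (abs_le.1 (hp _ (hy1 k))).2) h2 (hy4.mul_left δ)
  obtain ⟨N1, hN1⟩ := Metric.tendsto_atTop.1 htl (ε / 4) (by positivity)
  obtain ⟨N2, hN2⟩ := Metric.tendsto_atTop.1 hx4 1 one_pos
  refine ⟨max N1 N2, fun N hN => ?_⟩
  have h3 := hN1 N (le_of_max_le_left hN)
  have h4 := hN2 N (le_of_max_le_right hN)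
  have h5 : |∑ i, f (x N i) * x N i ^ 4 - ∑ i, p.eval (x N i) * x N i ^ 4| ≤
      δ * ∑ i, x N i ^ 4 := by
    rw [← Finset.sum_sub_distrib, Finset.mul_sum]
    exact (Finset.abs_sum_le_sum_abs _ _).trans (Finset.sum_le_sum fun i _ => hp _ (hx1 N i))
  rw [Real.dist_eq] at h3 h4 ⊢
  have h6 : δ * ∑ i, x N i ^ 4 ≤ δ * (L 0 + 1) :=
    mul_le_mul_of_nonneg_left (by linarith [(abs_lt.1 h4).2]) hδ0.le
  have h7 : δ * L 0 ≤ δ * (L 0 + 1) := mul_le_mul_of_nonneg_left (by linarith) hδ0.le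
  rw [abs_lt] at h3 ⊢
  rw [abs_le] at h1 h5
  constructor <;> linarith [h1.1, h1.2, h5.1, h5.2, h3.1, h3.2]

/-- Convergence of integrals of continuous functions vanishing near `0`. -/
theorem tendsto_sum_of_eq_zero (hx1 : ∀ N i, |x N i| ≤ 1) (hy1 : ∀ k, |y k| ≤ 1)
    (hy : ∀ j, HasSum (fun k => y k ^ (j + 4)) (L j))
    (hx : ∀ j, Tendsto (fun N => ∑ i, x N i ^ (j + 4)) atTop (𝓝 (L j)))
    {f : ℝ → ℝ} (hf : Continuous f) {ε : ℝ} (hε : 0 < ε) (hf0 : ∀ t, |t| ≤ ε → f t = 0) :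
    ∃ l, HasSum (fun k => f (y k)) l ∧ Tendsto (fun N => ∑ i, f (x N i)) atTop (𝓝 l) := by
  have hpos : ∀ t : ℝ, 0 < max |t| ε := fun t => lt_max_of_lt_right hε
  have e : ∀ t, f t / max |t| ε ^ 4 * t ^ 4 = f t := by
    intro t
    by_cases ht : |t| ≤ ε
    · simp [hf0 t ht]
    · rw [max_eq_left (not_le.1 ht).le, ← abs_pow, abs_of_nonneg (by positivity : 0 ≤ t ^ 4)]
      refine div_mul_cancel₀ _ (pow_ne_zero 4 ?_)
      rintro rfl
      simp [hε.le] at ht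
  have h := tendsto_sum_continuous hx1 hy1 hy hx (f := fun t => f t / max |t| ε ^ 4)
    (hf.div ((continuous_abs.max continuous_const).pow 4) fun t => (pow_pos (hpos t) 4).ne')
  simpa only [e] using h

/-- Convergence of the numbers of points in a set away from `0` whose boundary contains no point of
the limit configuration. -/
theorem tendsto_sum_indicator (hx1 : ∀ N i, |x N i| ≤ 1) (hy1 : ∀ k, |y k| ≤ 1)
    (hy : ∀ j, HasSum (fun k => y k ^ (j + 4)) (L j))
    (hx : ∀ j, Tendsto (fun N => ∑ i, x N i ^ (j + 4)) atTop (𝓝 (L j)))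
    {B : Set ℝ} (hB0 : (0 : ℝ) ∉ closure B) (hBf : ∀ k, y k ∉ frontier B) :
    ∃ l, HasSum (fun k => B.indicator (fun _ => (1 : ℝ)) (y k)) l ∧
      Tendsto (fun N => ∑ i, B.indicator (fun _ => (1 : ℝ)) (x N i)) atTop (𝓝 l) := by
  obtain ⟨ε, hε, hball⟩ := Metric.isOpen_iff.1 isClosed_closure.isOpen_compl 0 hB0
  have hfar : ∀ t ∈ closure B, ε ≤ |t| := by
    intro t ht
    by_contra! h
    exact hball (mem_ball_zero_iff.2 h) ht
  have hA : (y '' {k | ε / 2 ≤ |y k|}).Finite := by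
    refine Set.Finite.image _ ?_
    have h4 := (hy 0).summable.tendsto_cofinite_zero
    have h5 := h4.eventually_lt_const (show (0 : ℝ) < (ε / 2) ^ 4 by positivity)
    refine Set.Finite.subset h5 fun k hk => ?_
    have h6 := pow_le_pow_left₀ (half_pos hε).le (show ε / 2 ≤ |y k| from hk) 4
    rw [← abs_pow, abs_of_nonneg (by positivity : 0 ≤ y k ^ 4)] at h6
    simpa using h6
  set A := y '' {k | ε / 2 ≤ |y k|} with hAdef
  obtain ⟨f, hf0, hf1, hf01⟩ := exists_continuous_zero_one_of_isClosed
    (s := (A \ closure B) ∪ Metric.closedBall 0 (ε / 2)) (t := closure B)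
    ((hA.subset Set.sdiff_subset).isClosed.union Metric.isClosed_closedBall) isClosed_closure (by
      rw [Set.disjoint_left]
      rintro t (⟨_, h⟩ | h) ht
      · exact h ht
      · have := hfar t ht
        rw [mem_closedBall_zero_iff, Real.norm_eq_abs] at h
        linarith)
  obtain ⟨g, hg0, hg1, hg01⟩ := exists_continuous_zero_one_of_isClosed
    (s := (interior B)ᶜ) (t := A ∩ interior B) isOpen_interior.isClosed_compl
    (hA.subset Set.inter_subset_left).isClosed (by
      rw [Set.disjoint_left]
      exact fun t h ht => h ht.2)
  have hgB : ∀ t, g t ≤ B.indicator (fun _ => (1 : ℝ)) t := by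
    intro t
    by_cases ht : t ∈ B
    · rw [Set.indicator_of_mem ht]
      exact (hg01 t).2
    · rw [Set.indicator_of_notMem ht, hg0 fun h => ht (interior_subset h)]
      rfl
  have hfB : ∀ t, B.indicator (fun _ => (1 : ℝ)) t ≤ f t := by
    intro t
    by_cases ht : t ∈ B
    · rw [Set.indicator_of_mem ht, hf1 (subset_closure ht)]
      rfl
    · rw [Set.indicator_of_notMem ht]
      exact (hf01 t).1
  have hgy : ∀ k, g (y k) = B.indicator (fun _ => (1 : ℝ)) (y k) := by
    intro k
    refine le_antisymm (hgB _) ?_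
    by_cases ht : y k ∈ B
    · have hi : y k ∈ interior B := by
        by_contra h
        exact hBf k ⟨subset_closure ht, h⟩
      have hk : ε / 2 ≤ |y k| := by linarith [hfar _ (subset_closure ht)]
      rw [Set.indicator_of_mem ht, hg1 ⟨⟨k, hk, rfl⟩, hi⟩]
      rfl
    · rw [Set.indicator_of_notMem ht]
      exact (hg01 _).1
  have hfy : ∀ k, f (y k) = B.indicator (fun _ => (1 : ℝ)) (y k) := by
    intro k
    refine le_antisymm ?_ (hfB _)
    by_cases ht : y k ∈ B
    · rw [Set.indicator_of_mem ht]
      exact (hf01 _).2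
    · have hc : y k ∉ closure B := fun h => hBf k ⟨h, fun h' => ht (interior_subset h')⟩
      rw [Set.indicator_of_notMem ht, hf0]
      · rfl
      · by_cases hk : ε / 2 ≤ |y k|
        · exact Or.inl ⟨⟨k, hk, rfl⟩, hc⟩
        · refine Or.inr ?_
          rw [mem_closedBall_zero_iff, Real.norm_eq_abs]
          exact (not_le.1 hk).le
  obtain ⟨l, hl, hfl⟩ := tendsto_sum_of_eq_zero hx1 hy1 hy hx f.continuous (half_pos hε)
    fun t ht => hf0 (Or.inr (by rwa [mem_closedBall_zero_iff, Real.norm_eq_abs]))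
  obtain ⟨l', hl', hgl⟩ := tendsto_sum_of_eq_zero hx1 hy1 hy hx g.continuous (half_pos hε)
    fun t ht => hg0 fun h => by linarith [hfar t (subset_closure (interior_subset h))]
  simp only [hfy] at hl
  simp only [hgy] at hl'
  rw [hl'.unique hl] at hgl
  exact ⟨l, hl, tendsto_of_tendsto_of_tendsto_of_le_of_le hgl hfl
    (fun N => Finset.sum_le_sum fun i _ => hgB _) fun N => Finset.sum_le_sum fun i _ => hfB _⟩

/-- The measure version of `tendsto_sum_indicator`. -/
theorem tendsto_sum_dirac [Countable κ] (hx1 : ∀ N i, |x N i| ≤ 1) (hy1 : ∀ k, |y k| ≤ 1)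
    (hy : ∀ j, HasSum (fun k => y k ^ (j + 4)) (L j))
    (hx : ∀ j, Tendsto (fun N => ∑ i, x N i ^ (j + 4)) atTop (𝓝 (L j)))
    {B : Set ℝ} (hB : MeasurableSet B) (hB0 : (0 : ℝ) ∉ closure B)
    (hBf : Measure.sum (fun k => Measure.dirac (y k)) (frontier B) = 0) :
    Tendsto (fun N => (∑ i, Measure.dirac (x N i)) B) atTop
      (𝓝 (Measure.sum (fun k => Measure.dirac (y k)) B)) := by
  have hBf' : ∀ k, y k ∉ frontier B := by
    intro k hk
    rw [Measure.sum_apply _ measurableSet_frontier, ENNReal.tsum_eq_zero] at hBf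
    have := hBf k
    rw [Measure.dirac_apply' _ measurableSet_frontier, Set.indicator_of_mem hk] at this
    simp at this
  obtain ⟨l, hl, htl⟩ := tendsto_sum_indicator hx1 hy1 hy hx hB0 hBf'
  have e : ∀ t : ℝ, Measure.dirac t B = ENNReal.ofReal (B.indicator (fun _ => (1 : ℝ)) t) := by
    intro t
    rw [Measure.dirac_apply' _ hB]
    by_cases ht : t ∈ B <;> simp [ht]
  have hnn : ∀ t : ℝ, 0 ≤ B.indicator (fun _ => (1 : ℝ)) t := fun t =>
    Set.indicator_nonneg (fun _ _ => zero_le_one) t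
  rw [Measure.sum_apply _ hB]
  simp only [Measure.finsetSum_apply, e]
  rw [← ENNReal.ofReal_tsum_of_nonneg (fun k => hnn _) hl.summable, hl.tsum_eq]
  simp only [← ENNReal.ofReal_sum_of_nonneg fun i _ => hnn _]
  exact ENNReal.tendsto_ofReal htl

end

instance (n : ℕ) : MeasurableSingletonClass (SimpleGraph (Fin n)) where
  measurableSet_singleton G := by
    have h : ({G} : Set (SimpleGraph (Fin n))) =
        ⋂ u, ⋂ v, {H : SimpleGraph (Fin n) | H.Adj u v ↔ G.Adj u v} := by
      ext H
      simp only [Set.mem_singleton_iff, Set.mem_iInter, Set.mem_ofPred_eq]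
      constructor
      · rintro rfl u v
        rfl
      · intro h
        ext u v
        exact h u v
    rw [h]
    refine MeasurableSet.iInter fun u => MeasurableSet.iInter fun v => ?_
    have h1 := SimpleGraph.measurable_iff_adj.1 (measurable_id (α := SimpleGraph (Fin n))) u v
    exact measurableSet_setOfPred.2 (h1.iff measurable_const)

/-- The mean of a function of the graph is bounded by the supremum of its conditional means given
the labels. -/
theorem lintegral_law_le {d N : ℕ} {fIn fOut : Torus d → ℝ} (hIn : IsConnectivityFunction fIn)
    (hOut : IsConnectivityFunction fOut) {h : SimpleGraph (Fin (2 * N)) → ℝ} (h0 : ∀ G, 0 ≤ h G)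
    {C : ℝ} (hC : ∀ s ∈ balancedLabellings N, ∑ G, margProb fIn fOut s G * h G ≤ C) :
    ∫⁻ q, ENNReal.ofReal (h q.2.2) ∂law d N fIn fOut ≤ ENNReal.ofReal C := by
  have hmG : ∀ f : SimpleGraph (Fin (2 * N)) → ℝ≥0∞, Measurable f := fun f =>
    measurable_of_countable f
  have hm1 : ∀ s : Fin (2 * N) → Fin 2,
      Measurable fun q : (Fin (2 * N) → Torus d) × SimpleGraph (Fin (2 * N)) =>
        ENNReal.ofReal (graphProb fIn fOut s q.1 q.2) := fun s =>
    measurable_from_prod_countable_left fun G =>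
      (measurable_graphProb hIn hOut s G).ennreal_ofReal
  have hm2 : Measurable fun q : (Fin (2 * N) → Fin 2) × (Fin (2 * N) → Torus d) ×
      SimpleGraph (Fin (2 * N)) => ENNReal.ofReal (graphProb fIn fOut q.1 q.2.1 q.2.2) :=
    measurable_from_prod_countable_right fun s => hm1 s
  have hm3 : Measurable fun q : (Fin (2 * N) → Fin 2) × (Fin (2 * N) → Torus d) ×
      SimpleGraph (Fin (2 * N)) => ENNReal.ofReal (h q.2.2) :=
    (hmG fun G => ENNReal.ofReal (h G)).comp (measurable_snd.comp measurable_snd)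
  have hinner : ∀ s, ∫⁻ q : (Fin (2 * N) → Torus d) × SimpleGraph (Fin (2 * N)),
      ENNReal.ofReal (graphProb fIn fOut s q.1 q.2) * ENNReal.ofReal (h q.2)
        ∂(posMeasure d (Fin (2 * N))).prod Measure.count =
      ENNReal.ofReal (∑ G, margProb fIn fOut s G * h G) := by
    intro s
    have hi : ∀ G ∈ Finset.univ, Integrable (fun x => graphProb fIn fOut s x G * h G)
        (posMeasure d (Fin (2 * N))) :=
      fun G _ => (integrable_graphProb hIn hOut s G).mul_const _
    have hm4 : Measurable fun q : (Fin (2 * N) → Torus d) × SimpleGraph (Fin (2 * N)) =>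
        ENNReal.ofReal (graphProb fIn fOut s q.1 q.2) * ENNReal.ofReal (h q.2) :=
      (hm1 s).mul ((hmG fun G => ENNReal.ofReal (h G)).comp measurable_snd)
    rw [lintegral_prod _ hm4.aemeasurable, sum_margProb_mul hIn hOut,
      ofReal_integral_eq_lintegral_ofReal (integrable_finsetSum _ hi)
        (Eventually.of_forall fun x => Finset.sum_nonneg fun G _ =>
          mul_nonneg (graphProb_nonneg hIn hOut s x G) (h0 G))]
    refine lintegral_congr fun x => ?_
    rw [lintegral_count, tsum_fintype, ENNReal.ofReal_sum_of_nonneg fun G _ =>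
      mul_nonneg (graphProb_nonneg hIn hOut s x G) (h0 G)]
    exact Finset.sum_congr rfl fun G _ =>
      (ENNReal.ofReal_mul (graphProb_nonneg hIn hOut s x G)).symm
  rw [law, lintegral_withDensity_eq_lintegral_mul _ hm2 hm3,
    lintegral_prod _ (hm2.mul hm3).aemeasurable]
  calc _ = ∫⁻ s, ENNReal.ofReal (∑ G, margProb fIn fOut s G * h G)
        ∂uniformOn (balancedLabellings N) := lintegral_congr hinner
    _ ≤ ∫⁻ _s, ENNReal.ofReal C ∂uniformOn (balancedLabellings N) := by
        refine lintegral_mono_ae ?_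
        filter_upwards [ae_cond_mem (μ := Measure.count)
          (Set.toFinite (balancedLabellings N)).measurableSet] with s hs
        exact ENNReal.ofReal_le_ofReal (hC s hs)
    _ ≤ ENNReal.ofReal C := by
        rw [lintegral_const]
        refine mul_le_of_le_one_right' ?_
        unfold uniformOn
        exact prob_le_one

/-- Almost sure convergence of the normalized closed walk counts. -/
theorem ae_tendsto_moment {d : ℕ} {fIn fOut : Torus d → ℝ} (hIn : IsConnectivityFunction fIn)
    (hOut : IsConnectivityFunction fOut) {Ω : Type*} [MeasurableSpace Ω] {P : Measure Ω}
    {σ : ∀ N : ℕ, Ω → (Fin (2 * N) → Fin 2)} {X : ∀ N : ℕ, Ω → (Fin (2 * N) → Torus d)}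
    {G : ∀ N : ℕ, Ω → SimpleGraph (Fin (2 * N))}
    (hLaw : ∀ N : ℕ, HasLaw (fun ω => (σ N ω, X N ω, G N ω)) (law d N fIn fOut) P)
    {M : ℕ} (hM : 2 ≤ M) :
    ∀ᵐ ω ∂P, Tendsto (fun N : ℕ => (∑ w : Fin (M + 1) → Fin (2 * N), cyc w (G N ω)) /
      ((2 * N : ℕ) : ℝ) ^ (M + 1)) atTop (𝓝 (limitMoment fIn fOut M)) := by
  set h : ∀ N, SimpleGraph (Fin (2 * N)) → ℝ := fun N H =>
    ((∑ w : Fin (M + 1) → Fin (2 * N), cyc w H) / ((2 * N : ℕ) : ℝ) ^ (M + 1) -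
      limitMoment fIn fOut M) ^ 2 with hh
  have hmeas : ∀ N, AEMeasurable (fun ω => ENNReal.ofReal (h N (G N ω))) P := fun N =>
    (measurable_of_countable fun H => ENNReal.ofReal (h N H)).comp_aemeasurable
      (hLaw N).aemeasurable.snd.snd
  have hbound : ∀ N, ∫⁻ ω, ENNReal.ofReal (h (N + 1) (G (N + 1) ω)) ∂P ≤
      ENNReal.ofReal (((M + 1 : ℕ) : ℝ) ^ 4 * (1 / ((N + 1 : ℕ) : ℝ) ^ 2)) := by
    intro N
    have h1 := lintegral_law_le (N := N + 1) hIn hOut (h := h (N + 1)) (fun H => sq_nonneg _)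
      (fun s hs => second_moment_le hIn hOut rfl N.succ_pos hM hs)
    have h2 := (hLaw (N + 1)).lintegral_comp (f := fun q => ENNReal.ofReal (h (N + 1) q.2.2))
      ((measurable_of_countable fun H => ENNReal.ofReal (h (N + 1) H)).comp
        (measurable_snd.comp measurable_snd)).aemeasurable
    refine (h2.trans_le h1).trans (ENNReal.ofReal_le_ofReal (le_of_eq ?_))
    push_cast
    field_simp
    norm_num
  have hsum : ∑' N : ℕ, ENNReal.ofReal (((M + 1 : ℕ) : ℝ) ^ 4 * (1 / ((N + 1 : ℕ) : ℝ) ^ 2)) ≠ ∞ := by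
    have hs : Summable fun N : ℕ => ((M + 1 : ℕ) : ℝ) ^ 4 * (1 / ((N + 1 : ℕ) : ℝ) ^ 2) :=
      ((summable_nat_add_iff 1).2 (Real.summable_one_div_nat_pow.2 one_lt_two)).mul_left _
    exact hs.tsum_ofReal_ne_top
  have hfin : ∫⁻ ω, ∑' N, ENNReal.ofReal (h (N + 1) (G (N + 1) ω)) ∂P ≠ ∞ := by
    rw [lintegral_tsum fun N => hmeas (N + 1)]
    exact ne_top_of_le_ne_top hsum (ENNReal.tsum_le_tsum hbound)
  filter_upwards [ae_lt_top' (AEMeasurable.tsum fun N => hmeas (N + 1)) hfin] with ω hω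
  have h1 := ENNReal.tendsto_atTop_zero_of_tsum_ne_top hω.ne
  have h2 := (ENNReal.tendsto_toReal ENNReal.zero_ne_top).comp h1
  simp only [Function.comp_def, ENNReal.toReal_ofReal (sq_nonneg _), hh, ENNReal.toReal_zero] at h2
  rw [← tendsto_add_atTop_iff_nat 1, tendsto_iff_norm_sub_tendsto_zero]
  have h3 := (Real.continuous_sqrt.tendsto 0).comp h2
  simpa only [Function.comp_def, Real.sqrt_sq_eq_abs, Real.sqrt_zero, ← Real.norm_eq_abs] using h3

theorem limitMeasure_eq_sum {d : ℕ} (fIn fOut : Torus d → ℝ) :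
    limitMeasure fIn fOut = Measure.sum fun k : (Fin d → ℤ) ⊕ (Fin d → ℤ) =>
      Measure.dirac (Sum.elim
        (fun k => ((fourierHat fIn k).re + (fourierHat fOut k).re) / 2)
        (fun k => ((fourierHat fIn k).re - (fourierHat fOut k).re) / 2) k) := by
  ext s hs
  rw [limitMeasure, Measure.sum_apply _ hs, Measure.sum_apply _ hs,
    Summable.tsum_sum ENNReal.summable ENNReal.summable]
  simp only [Measure.add_apply, Sum.elim_inl, Sum.elim_inr]
  exact ENNReal.tsum_add

theorem hasSum_limit_points {d : ℕ} {fIn fOut : Torus d → ℝ} (hIn : IsConnectivityFunction fIn)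
    (hOut : IsConnectivityFunction fOut) (j : ℕ) :
    HasSum (fun k : (Fin d → ℤ) ⊕ (Fin d → ℤ) => Sum.elim
        (fun k => ((fourierHat fIn k).re + (fourierHat fOut k).re) / 2)
        (fun k => ((fourierHat fIn k).re - (fourierHat fOut k).re) / 2) k ^ (j + 4))
      (limitMoment fIn fOut (j + 3)) := by
  set a : (Fin d → ℤ) → ℝ := fun k => ((fourierHat fIn k).re + (fourierHat fOut k).re) / 2 with ha
  set b : (Fin d → ℤ) → ℝ := fun k => ((fourierHat fIn k).re - (fourierHat fOut k).re) / 2 with hb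
  have h4 : Summable fun k => a k ^ 4 + b k ^ 4 := (hasSum_limitMoment hIn hOut 2).summable
  have hab : ∀ k, |a k| ≤ 1 ∧ |b k| ≤ 1 := by
    intro k
    have h1 := abs_le.1 (abs_re_fourierHat_le hIn k)
    have h2 := abs_le.1 (abs_re_fourierHat_le hOut k)
    simp only [ha, hb, abs_le]
    refine ⟨⟨?_, ?_⟩, ?_, ?_⟩ <;> linarith [h1.1, h1.2, h2.1, h2.2]
  have hbd : ∀ t : ℝ, |t| ≤ 1 → ‖t ^ (j + 4)‖ ≤ t ^ 4 := by
    intro t ht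
    rw [norm_pow, Real.norm_eq_abs, ← Even.pow_abs (by decide : Even 4) t]
    exact pow_le_pow_of_le_one (abs_nonneg t) ht (by omega)
  have hsa : Summable fun k => a k ^ (j + 4) := Summable.of_norm_bounded h4 fun k =>
    (hbd _ (hab k).1).trans (le_add_of_nonneg_right (by positivity))
  have hsb : Summable fun k => b k ^ (j + 4) := Summable.of_norm_bounded h4 fun k =>
    (hbd _ (hab k).2).trans (le_add_of_nonneg_left (by positivity))
  rw [(hasSum_limitMoment hIn hOut (j + 2)).unique (hsa.hasSum.add hsb.hasSum)]
  exact HasSum.sum hsa.hasSum hsb.hasSum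

end SGBM

theorem mainTheorem3 (d : ℕ) (fIn fOut : SGBM.Torus d → ℝ)
    (hIn : SGBM.IsConnectivityFunction fIn) (hOut : SGBM.IsConnectivityFunction fOut)
    (S : ℕ → Finset (Fin d → ℤ)) (hS : Tendsto S atTop atTop)
    (hInZero : SGBM.EqualsFourierSeriesAtZero S fIn)
    (hOutZero : SGBM.EqualsFourierSeriesAtZero S fOut)
    {Ω : Type*} [MeasurableSpace Ω] (P : Measure Ω) [IsProbabilityMeasure P]
    (σ : ∀ N : ℕ, Ω → (Fin (2 * N) → Fin 2))
    (X : ∀ N : ℕ, Ω → (Fin (2 * N) → SGBM.Torus d))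
    (G : ∀ N : ℕ, Ω → SimpleGraph (Fin (2 * N)))
    (hLaw : ∀ N : ℕ, HasLaw (fun ω => (σ N ω, X N ω, G N ω)) (SGBM.law d N fIn fOut) P)
    (B : Set ℝ) (hB : MeasurableSet B)
    (hBfrontier : SGBM.limitMeasure fIn fOut (frontier B) = 0)
    (hBzero : (0 : ℝ) ∉ closure B) :
    ∀ᵐ ω ∂P, Tendsto (fun N : ℕ => SGBM.spectralMeasure (G N ω) B) atTop
      (𝓝 (SGBM.limitMeasure fIn fOut B)) := by
  classical
  have hmom : ∀ᵐ ω ∂P, ∀ j : ℕ, Tendsto (fun N : ℕ =>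
      (∑ w : Fin (j + 3 + 1) → Fin (2 * N), SGBM.cyc w (G N ω)) /
        ((2 * N : ℕ) : ℝ) ^ (j + 3 + 1)) atTop (𝓝 (SGBM.limitMoment fIn fOut (j + 3))) :=
    ae_all_iff.2 fun j => SGBM.ae_tendsto_moment hIn hOut hLaw (by omega)
  rw [SGBM.limitMeasure_eq_sum] at hBfrontier ⊢
  filter_upwards [hmom] with ω hω
  refine SGBM.tendsto_sum_dirac (ι := fun N => Fin (2 * N)) ?_ ?_
    (SGBM.hasSum_limit_points hIn hOut) ?_ hB hBzero hBfrontier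
  · intro N i
    rw [abs_div, Nat.abs_cast]
    exact div_le_one_of_le₀ (SGBM.abs_eigenvalues_adjMatrix_le _ i) (Nat.cast_nonneg _)
  · rintro (k | k) <;>
    · have h1 := abs_le.1 (SGBM.abs_re_fourierHat_le hIn k)
      have h2 := abs_le.1 (SGBM.abs_re_fourierHat_le hOut k)
      simp only [Sum.elim_inl, Sum.elim_inr, abs_le]
      constructor <;> linarith [h1.1, h1.2, h2.1, h2.2]
  · intro j
    refine (hω j).congr fun N => ?_
    simp only [div_pow, ← Finset.sum_div]
    rw [← SGBM.sum_eigenvalues_adjMatrix_pow]
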